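/- Let $d\ge 2$ be fixed. For tuples $t,t'\in\mathbb R^d$, $t$ dominates $t'$ if $t_i\le t'_i$ for all $i$ and $t_j<t'_j$ for some $j$; the skyline of a finite family of tuples consists of the tuples in it that are dominated by no tuple in it. The baseline algorithm takes a relation $T$ of $n$ tuples in $\mathbb R^d$, held in random-access memory, and a sample size $m\le n$. Step 1 draws a sample $S$ of $m$ tuples of $T$ uniformly at random without replacement (by a partial shuffle). Step 2 returns the skyline of $S$, computed by FLET: on an input of $m$ tuples, FLET chooses a virtual tuple $x$ whose $i$-th coordinate is an empirical quantile of the $i$-th attribute of order about $(\log m/m)^{1/d}$, taken from the first $\lfloor\sqrt m\rfloor$ tuples; it scans the input once and discards every tuple that exceeds $x$ strictly in all attributes; if during the scan some tuple $\le x$ (in all attributes) was seen, it applies the multidimensional divide-and-conquer skyline algorithm to the remaining tuples, otherwise it applies that algorithm to the whole input. The running time is the number of elementary steps (procedure calls, comparisons of attribute values, random draws, memory and list-cell accesses, integer operations). Let $W(n,m)$ be the worst-case running time, i.e. the supremum over all relations $T$ of $n$ tuples (duplicates and ties allowed) and all random choices. For probability measures $\mu_1,\dots,\mu_d$ on $\mathbb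 R$ without atoms, let $A_\mu(n,m)$ be the average-case running time, i.e. the expected running time when the $n$ tuples are i.i.d., the attributes of a tuple are independent with the $i$-th one distributed according to $\mu_i$, and the random choices are independent of the tuples. There is a constant $C$ depending only on $d$ such that: 1. $W(n,m)\le C\,m\,(\log m)^{\max(d-2,1)}$ for all $2\le m\le n$. That is, the worst-case time is $O(m\log^{d-2}m)$ if $d\ge 3$, and $O(m\log m)$ if $d=2$. 2. $A_\mu(n,m)\le C\,m$ for all $1\le m\le n$ and all $\mu_1,\dots,\mu_d$ as above. That is, the average-case time is $O(m)$. 3. Let $k>1$ be real, and let the sample size be $m=\lfloor n^{1/k}\rfloor$. Then $W(n,m)\le C\,n^{1/k}\,(\log n^{1/k})^{\max(d-2,1)}$ for all $n$ with $n^{1/k}\ge 2$, and $A_\mu(n,m)\le C\,n^{1/k}$ for all $n\ge 1$ and all $\mu_1,\dots,\mu_d$ as above. In particular the running time is sublinear: $W(n,m)/n\to 0$ and $A_\mu(n,m)/n\to 0$ as $n\to\infty$. -/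

import Mathlib

open MeasureTheory Filter Topology
open scoped ENNReal

namespace SkylineSampling

/-! ### Cost model

A program of type `Timed β` is a value together with the number of elementary steps spent on
computing it. Charged are: every call of a recursive procedure, every comparison of two attribute
values, every random draw, every read or write of a memory cell, every list cell that is visited,
copied or counted, and every integer operation. Attribute values are accessed through comparisons
only. -/

/-- A value together with the number of elementary steps spent on computing it. -/
structure Timed (β : Type) where
  val : β
  cost : ℕ

instance : Monad Timed where
  pure b := ⟨b, 0⟩
  bind x f := ⟨(f x.val).val, x.cost + (f x.val).cost⟩

/-- Spend `c` elementary steps. -/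
def tick (c : ℕ) : Timed Unit := ⟨(), c⟩

section Algorithms

variable {α : Type} [LinearOrder α] {d : ℕ}

/-- Compare two tuples on attribute `i`: one step. -/
def leAt (i : Fin d) (p q : Fin d → α) : Timed Bool := ⟨decide (p i ≤ q i), 1⟩

/-- Lexicographic comparison of two tuples along a list of attributes. -/
def lexLe : List (Fin d) → (Fin d → α) → (Fin d → α) → Timed Bool
  | [], _, _ => do
      tick 1
      pure true
  | i :: is, p, q => do
      tick 1
      let pq ← leAt i p q
      let qp ← leAt i q p
      if pq && qp then lexLe is p q else pure pq

/-- Equality test of two tuples along a list of attributes. -/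
def eqOn : List (Fin d) → (Fin d → α) → (Fin d → α) → Timed Bool
  | [], _, _ => do
      tick 1
      pure true
  | i :: is, p, q => do
      tick 1
      let pq ← leAt i p q
      let qp ← leAt i q p
      if pq && qp then eqOn is p q else pure false

/-! ### Divide and conquer on lists, merge sort -/

/-- Divide and conquer: cut the list in the middle (counting the list and cutting it visits at most
`2 * l.length` cells), solve both halves, and combine the two results. -/
def divideConquer {X Y : Type} (empty : Y) (leaf : X → Y) (combine : Y → Y → Timed Y)
    (l : List X) : Timed Y :=
  match l with
  | [] => do
      tick 1
      pure empty
  | [x] => do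
      tick 1
      pure (leaf x)
  | x :: x' :: xs => do
      tick (1 + 2 * (x :: x' :: xs).length)
      let y₁ ← divideConquer empty leaf combine
        ((x :: x' :: xs).take ((x :: x' :: xs).length / 2))
      let y₂ ← divideConquer empty leaf combine
        ((x :: x' :: xs).drop ((x :: x' :: xs).length / 2))
      combine y₁ y₂
termination_by l.length
decreasing_by
  all_goals simp only [List.length_take, List.length_drop, List.length_cons]; omega

/-- Merge two lists that are sorted with respect to `le`. -/
def merge {X : Type} (le : X → X → Timed Bool) : List X → List X → Timed (List X)
  | [], ys => do
      tick 1
      pure ys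
  | x :: xs, [] => do
      tick 1
      pure (x :: xs)
  | x :: xs, y :: ys => do
      tick 1
      let b ← le x y
      if b then do
        let r ← merge le xs (y :: ys)
        pure (x :: r)
      else do
        let r ← merge le (x :: xs) ys
        pure (y :: r)
termination_by xs ys => xs.length + ys.length

/-- Merge sort. -/
def mergeSort {X : Type} (le : X → X → Timed Bool) (l : List X) : Timed (List X) :=
  divideConquer [] (fun x => [x]) (merge le) l

/-! ### The multidimensional divide-and-conquer skyline algorithm -/

/-- Does the tuple stored in `best` (if any) have an `j`-value that is at most that of `b`? -/
def coveredBy (j : Fin d) : Option (Fin d → α) → (Fin d → α) → Timed Bool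
  | none, _ => do
      tick 1
      pure false
  | some p, b => leAt j p b

/-- Plane sweep. The lists `A` and `B` are sorted by attribute `c`. Delete from `B` every tuple `b`
for which some `a` in `A` has `a c ≤ b c` and `a j ≤ b j`. The tuple `best` has the least `j`-value
among the tuples of `A` passed so far. -/
def sweep (c j : Fin d) (best : Option (Fin d → α)) :
    List (Fin d → α) → List (Fin d → α) → Timed (List (Fin d → α))
  | _, [] => do
      tick 1
      pure []
  | [], b :: bs => do
      tick 1
      let covered ← coveredBy j best b
      let r ← sweep c j best [] bs
      if covered then pure r else pure (b :: r)
  | a :: as, b :: bs => do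
      tick 1
      let before ← leAt c a b
      if before then do
        let useless ← coveredBy j best a
        sweep c j (if useless then best else some a) as (b :: bs)
      else do
        let covered ← coveredBy j best b
        let r ← sweep c j best (a :: as) bs
        if covered then pure r else pure (b :: r)
termination_by A B => A.length + B.length

/-- The tuple behind a marked tuple. -/
def untag : (Fin d → α) ⊕ (Fin d → α) → (Fin d → α)
  | .inl p => p
  | .inr p => p

/-- Order of marked tuples by attribute `k`; on ties, tuples marked `inl` come first. -/
def tagLe (k : Fin d) (x y : (Fin d → α) ⊕ (Fin d → α)) : Timed Bool :=
  match x, y with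
  | .inr b, .inl a => do
      let ab ← leAt k a b
      pure (!ab)
  | x, y => leAt k (untag x) (untag y)

/-- A marked tuple as a pair (tuples marked `inl`, tuples marked `inr`). -/
def untagSingle : (Fin d → α) ⊕ (Fin d → α) → List (Fin d → α) × List (Fin d → α)
  | .inl a => ([a], [])
  | .inr b => ([], [b])

/-- The filtering step. The lists `A` and `B` are sorted by attribute `c`. Delete from `B` every
tuple `b` for which some `a` in `A` has `a i ≤ b i` for `i = c` and for all `i` in the list of
attributes; the result is again sorted by attribute `c`. With at most one attribute besides `c`,
this is a plane sweep. Otherwise `A` and `B` are sorted together by the first attribute `k` and cut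
in the middle; after both halves have been treated, `B`-tuples of the upper half are filtered by
`A`-tuples of the lower half with respect to the attributes other than `k`. -/
def cross (c : Fin d) :
    List (Fin d) → List (Fin d → α) → List (Fin d → α) → Timed (List (Fin d → α))
  | [], A, B => sweep c c none A B
  | [j], A, B => sweep c j none A B
  | k :: j :: ks, A, B => do
      tick (1 + 2 * (A.length + B.length))
      let L ← mergeSort (tagLe k) (A.map Sum.inl ++ B.map Sum.inr)
      let AB ← divideConquer ([], []) untagSingle
        (fun (x y : List (Fin d → α) × List (Fin d → α)) => do
          let B₂ ← cross c (j :: ks) x.1 y.2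
          let A' ← merge (leAt c) x.1 y.1
          let B' ← merge (leAt c) x.2 B₂
          pure (A', B')) L
      pure AB.2

/-- Collect equal neighbours of a list into groups. -/
def group (is : List (Fin d)) : List (Fin d → α) → Timed (List (List (Fin d → α)))
  | [] => do
      tick 1
      pure []
  | p :: ps => do
      tick 1
      let gs ← group is ps
      match gs with
      | (q :: g) :: gs' => do
          let e ← eqOn is p q
          if e then pure ((p :: q :: g) :: gs') else pure ([p] :: (q :: g) :: gs')
      | _ => pure ([p] :: gs)

/-- Divide-and-conquer skyline: sort the tuples lexicographically, starting with attribute `k`, so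
that a tuple can only be dominated by earlier ones, and collect duplicates; then recursively
compute the skylines of the lower and the upper half and filter the latter by the former with
respect to the attributes `c` and `ks` (all attributes other than `k`). -/
def skyDCAux (c k : Fin d) (ks : List (Fin d)) (P : List (Fin d → α)) :
    Timed (List (Fin d → α)) := do
  let L ← mergeSort (lexLe (k :: c :: ks)) P
  let G ← group (k :: c :: ks) L
  divideConquer [] (fun g => g)
    (fun R₁ R₂ => do
      let R₂' ← cross c ks R₁ R₂
      merge (leAt c) R₁ R₂') G

/-- The divide-and-conquer skyline algorithm (with respect to all `d` attributes). -/
def skyDC (P : List (Fin d → α)) : Timed (List (Fin d → α)) :=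
  match List.finRange d with
  | [] => pure P
  | [c] => skyDCAux c c [] P
  | c :: k :: ks => skyDCAux c k ks P

/-! ### FLET (fast linear expected time) -/

/-- Linear search for the first number `≥ k` with property `p` (at most `fuel` numbers are tried).
Testing the number `k` is charged `k + 2 * d + 1` integer operations. -/
def search (d : ℕ) (p : ℕ → Bool) : ℕ → ℕ → Timed ℕ
  | 0, k => do
      tick 1
      pure k
  | fuel + 1, k => do
      tick (k + 2 * d + 1)
      if p k then pure k else search d p fuel (k + 1)

/-- A virtual tuple `x`, given by attributes `i` together with a tuple whose `i`-value is `x i`.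
For every attribute `i` in the list, `x i` is the `k`-th smallest `i`-value of the tuples in `Q`. -/
def virtualPoint (Q : List (Fin d → α)) (k : ℕ) :
    List (Fin d) → Timed (List (Fin d × (Fin d → α)))
  | [] => do
      tick 1
      pure []
  | i :: is => do
      tick (1 + k)
      let L ← mergeSort (leAt i) Q
      let x ← virtualPoint Q k is
      match L.drop (k - 1) with
      | w :: _ => pure ((i, w) :: x)
      | [] => pure x

/-- Is `p i ≤ x i` for every attribute `i` of the virtual tuple `x`? -/
def allLe (p : Fin d → α) : List (Fin d × (Fin d → α)) → Timed Bool
  | [] => do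
      tick 1
      pure true
  | (i, w) :: x => do
      tick 1
      let b ← leAt i p w
      if b then allLe p x else pure false

/-- Is `x i < p i` for every attribute `i` of the virtual tuple `x`? -/
def allGt (p : Fin d → α) : List (Fin d × (Fin d → α)) → Timed Bool
  | [] => do
      tick 1
      pure true
  | (i, w) :: x => do
      tick 1
      let b ← leAt i p w
      if b then pure false else allGt p x

/-- Scan the tuples: find out whether some tuple is `≤` the virtual tuple `x` on all attributes,
and throw away the tuples that `x` strictly dominates on all attributes. -/
def scan (x : List (Fin d × (Fin d → α))) :
    List (Fin d → α) → Timed (Bool × List (Fin d → α))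
  | [] => do
      tick 1
      pure (false, [])
  | p :: ps => do
      tick 1
      let r ← scan x ps
      let below ← allLe p x
      let above ← allGt p x
      pure (below || r.1, if above then r.2 else p :: r.2)

/-- FLET. With `n` the number of tuples, a virtual tuple `x` is chosen whose `i`-th coordinate is an
empirical quantile of attribute `i` of order about `(log n / n) ^ (1 / d)`, taken from the first
`⌊√n⌋` tuples. One scan throws away the tuples strictly dominated by `x`. If during the scan a tuple
`≤ x` was seen, the tuples thrown away are dominated by it, and the divide-and-conquer algorithm is
applied to the remaining tuples; otherwise it is applied to all tuples. (There is at least one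
attribute.) -/
def flet (P : List (Fin d → α)) : Timed (List (Fin d → α)) := do
  tick (1 + P.length)
  let lg ← search d (fun l => decide (P.length < 2 ^ (l + 1))) P.length 0
  let s ← search d (fun s => decide (P.length < (s + 1) ^ 2)) P.length 0
  let k ← search d (fun k => decide (s ^ d * lg ≤ k ^ d * P.length)) s 1
  tick s
  let x ← virtualPoint (P.take s) k (List.finRange d)
  let r ← scan x P
  if r.1 then skyDC r.2 else skyDC P

/-! ### The baseline algorithm -/

/-- The random choices made when drawing `m` out of `n` tuples without replacement: in round `i`
an index is drawn from the `n - i` remaining ones. -/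
abbrev Draws (n m : ℕ) : Type := (i : Fin m) → Fin (n - i)

/-- Sampling without replacement, as a partial shuffle of the memory cells `T 0, …, T (n - 1)`: in
round `i`, draw an index `j` with `i ≤ j < n`, output the content of cell `j`, and move the content
of cell `i` (which is not used any more) to cell `j`. Five steps per round: the call, the draw, two
reads and one write. -/
def sampleLoop {n m : ℕ} (h : m ≤ n) (ρ : Draws n m) :
    List (Fin m) → (Fin n → Fin d → α) → Timed (List (Fin d → α))
  | [], _ => do
      tick 1
      pure []
  | i :: is, T => do
      tick 5
      let j : Fin n := ⟨i + ρ i, by have := (ρ i).isLt; omega⟩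
      let S ← sampleLoop h ρ is (Function.update T j (T (Fin.castLE h i)))
      pure (T j :: S)

/-- The baseline algorithm with FLET as the skyline subroutine: draw a sample of `m` of the `n`
tuples of `T`, and return the skyline of the sample. The tuples of `T` are held in memory, with
random access. -/
def baseline {n m : ℕ} (h : m ≤ n) (T : Fin n → Fin d → α) (ρ : Draws n m) :
    Timed (List (Fin d → α)) := do
  let S ← sampleLoop h ρ (List.finRange m) T
  flet S

end Algorithms

/-! ### Worst-case and average-case running time -/

/-- Worst-case running time of the baseline algorithm: the supremum over all relations with `n`
tuples and `d` real attributes, and over all random choices. -/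
noncomputable def worstCaseTime (d : ℕ) {n m : ℕ} (h : m ≤ n) : ℝ≥0∞ :=
  ⨆ (T : Fin n → Fin d → ℝ) (ρ : Draws n m), ((baseline h T ρ).cost : ℝ≥0∞)

/-- Average-case running time of the baseline algorithm: the expected number of steps, where the
`n` tuples are i.i.d., the `i`-th attribute of a tuple has the distribution `μ i`, the attributes
are independent of each other, and the random choices are uniform and independent of the tuples. -/
noncomputable def averageTime {d : ℕ} (μ : Fin d → Measure ℝ) {n m : ℕ} (h : m ≤ n) : ℝ≥0∞ :=
  ∫⁻ T : Fin n → Fin d → ℝ,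
    (∑ ρ : Draws n m, ((baseline h T ρ).cost : ℝ≥0∞)) / (Fintype.card (Draws n m) : ℝ≥0∞)
    ∂(Measure.pi fun _ : Fin n => Measure.pi μ)

/-- The sample size `n ^ (1 / k)`, rounded down. -/
noncomputable def rootSize (k : ℝ) (n : ℕ) : ℕ := ⌊(n : ℝ) ^ (1 / k)⌋₊

theorem rootSize_le {k : ℝ} (hk : 1 < k) (n : ℕ) : rootSize k n ≤ n := by
  unfold rootSize
  rcases Nat.eq_zero_or_pos n with rfl | hn
  · rw [Nat.cast_zero, Real.zero_rpow (by positivity)]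
    simp
  · refine Nat.floor_le_of_le ?_
    have h1 : (1 : ℝ) ≤ n := by exact_mod_cast hn
    have h2 : 1 / k ≤ 1 := by
      rw [div_le_one (by linarith)]
      exact hk.le
    calc (n : ℝ) ^ (1 / k) ≤ (n : ℝ) ^ (1 : ℝ) := Real.rpow_le_rpow_of_exponent_le h1 h2
      _ = n := Real.rpow_one _

end SkylineSampling

/-! Sampling costs 5m + 1 steps whatever is drawn, so everything rests on the cost of FLET on m
tuples. Choosing the virtual tuple x and scanning are linear: the searches return numbers of order
at most √m, and only √m tuples are sorted. Hence FLET costs O(m + L^p r), where L = ⌊log₂ m⌋ + 1, p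
= max (d - 2) 1, and r is the number of tuples handed to divide and conquer (`flet_cost`). Here p
comes from the recursion: a plane sweep settles the last two attributes in linear time after
sorting, and each further attribute costs one level of divide and conquer, that is, one factor L
(`cross_cost`, `skyDCAux_cost`).

Worst case: r ≤ m.

Average case: it suffices that L^p E[r] = O(m). The coordinate x i is the k-th smallest of s = ⌊√m⌋
independent values, with k/s of order (log m / m)^(1/d) up to rounding. Fix lower sets D i and E i
of measure u = k/(4s) and v = min(1, 4k/s); they exist because the distributions have no atoms.
Typically x i lies outside D i and inside E i. If moreover some tuple has all values in the sets D
i, that tuple is ≤ x, so every surviving tuple has a value in some E i, and at most d·v·m survivors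
are expected. There are three ways to fail: too many sample values in D i, too few in E i, or no
tuple in the box of the D i. The first two are controlled by exponential moments
(`half_pow_mul_le_exp`, `two_pow_mul_le`), the third by (1 - u^d)^(m - s). All error terms, and v
itself, stay bounded after multiplication by any fixed power of L
(`exists_log_pow_mul_expected_le`).

For fixed random choices the sample is T ∘ σ with σ injective and independent of T
(`exists_sample_eq_comp`), so it is again an i.i.d. family and the same bound holds for every draw.
For m = ⌊n^(1/k)⌋ the bounds are monotone in m, and n^(1/k) times a power of its logarithm is o(n).
-/

namespace SkylineSampling

/-! ### Step counts -/

namespace Timed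

variable {β γ : Type}

@[simp] theorem val_bind (x : Timed β) (f : β → Timed γ) : (x >>= f).val = (f x.val).val := rfl

@[simp] theorem cost_bind (x : Timed β) (f : β → Timed γ) :
    (x >>= f).cost = x.cost + (f x.val).cost := rfl

@[simp] theorem val_pure (b : β) : (pure b : Timed β).val = b := rfl

@[simp] theorem cost_pure (b : β) : (pure b : Timed β).cost = 0 := rfl

@[simp] theorem cost_tick (c : ℕ) : (tick c).cost = c := rfl

@[simp] theorem val_ite (P : Prop) [Decidable P] (x y : Timed β) :
    (if P then x else y).val = if P then x.val else y.val := by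
  split_ifs <;> rfl

@[simp] theorem cost_ite (P : Prop) [Decidable P] (x y : Timed β) :
    (if P then x else y).cost = if P then x.cost else y.cost := by
  split_ifs <;> rfl

end Timed

/-! ### Cost of divide and conquer, merging and merge sort. -/

section Generic

variable {X Y : Type}

theorem divideConquer_cons_cons (empty : Y) (leaf : X → Y) (combine : Y → Y → Timed Y)
    (x x' : X) (xs : List X) :
    divideConquer empty leaf combine (x :: x' :: xs) = (do
      tick (1 + 2 * (x :: x' :: xs).length)
      let y₁ ← divideConquer empty leaf combine
        ((x :: x' :: xs).take ((x :: x' :: xs).length / 2))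
      let y₂ ← divideConquer empty leaf combine
        ((x :: x' :: xs).drop ((x :: x' :: xs).length / 2))
      combine y₁ y₂) := by
  rw [divideConquer]

/-- Induction along the recursion of `divideConquer`. -/
theorem divideConquer_induction {empty : Y} {leaf : X → Y} {combine : Y → Y → Timed Y}
    {motive : List X → Y → Prop} (h_nil : motive [] empty) (h_single : ∀ x, motive [x] (leaf x))
    (h_append : ∀ l₁ l₂ y₁ y₂, motive l₁ y₁ → motive l₂ y₂ →
      motive (l₁ ++ l₂) (combine y₁ y₂).val) (l : List X) :
    motive l (divideConquer empty leaf combine l).val := by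
  induction l using divideConquer.induct with
  | case1 => simpa [divideConquer] using h_nil
  | case2 x => simpa [divideConquer] using h_single x
  | case3 x x' xs ih₁ ih₂ =>
    rw [divideConquer_cons_cons]
    have := h_append _ _ _ _ ih₁ ih₂
    rwa [List.take_append_drop] at this

theorem divideConquer_size {empty : Y} {leaf : X → Y} {combine : Y → Y → Timed Y}
    (w : X → ℕ) (size : Y → ℕ) (h_nil : size empty = 0) (h_single : ∀ x, size (leaf x) ≤ w x)
    (h_combine : ∀ y₁ y₂, size (combine y₁ y₂).val ≤ size y₁ + size y₂) (l : List X) :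
    size (divideConquer empty leaf combine l).val ≤ (l.map w).sum := by
  refine divideConquer_induction (motive := fun l y => size y ≤ (l.map w).sum) ?_ ?_ ?_ l
  · simp [h_nil]
  · simpa using h_single
  · intro l₁ l₂ y₁ y₂ h₁ h₂
    have := h_combine y₁ y₂
    simp only [List.map_append, List.sum_append]
    omega

/-- Every level of the recursion tree handles total size at most the weight of `l`, and there are
`Nat.clog 2 l.length` levels. The rate `K` is required only for inputs of total size at most `N`,
because in the applications `K` itself contains powers of log `N`. The length is added to the weight
since `size` may vanish while every call still costs a step. -/
theorem divideConquer_cost {empty : Y} {leaf : X → Y} {combine : Y → Y → Timed Y}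
    (w : X → ℕ) (size : Y → ℕ) (h_nil : size empty = 0) (h_single : ∀ x, size (leaf x) ≤ w x)
    (h_combine : ∀ y₁ y₂, size (combine y₁ y₂).val ≤ size y₁ + size y₂) (N K : ℕ)
    (h_cost : ∀ y₁ y₂, size y₁ + size y₂ ≤ N →
      (combine y₁ y₂).cost ≤ K * (size y₁ + size y₂ + 1)) (l : List X) (hl : (l.map w).sum ≤ N) :
    (divideConquer empty leaf combine l).cost
      ≤ (K + 3) * ((l.map w).sum + l.length) * Nat.clog 2 l.length + 2 * l.length + 1 := by
  induction l using divideConquer.induct with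
  | case1 => simp [divideConquer]
  | case2 x => simp [divideConquer]
  | case3 x x' xs ih₁ ih₂ =>
    rw [divideConquer_cons_cons]
    set l := x :: x' :: xs with hl_def
    have hn : 2 ≤ l.length := by simp [hl_def]
    have h_sum : ((l.take (l.length / 2)).map w).sum + ((l.drop (l.length / 2)).map w).sum
        = (l.map w).sum := by
      rw [← List.sum_append, ← List.map_append, List.take_append_drop]
    have s₁ := divideConquer_size w size h_nil h_single h_combine (l.take (l.length / 2))
    have s₂ := divideConquer_size w size h_nil h_single h_combine (l.drop (l.length / 2))
    have c := h_cost _ _ ((Nat.add_le_add s₁ s₂).trans (h_sum.le.trans hl))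
    have ih₁ := ih₁ (by omega)
    have ih₂ := ih₂ (by omega)
    -- The larger half has ⌈n/2⌉ elements, and `Nat.clog` satisfies exactly this recursion.
    have h_clog : Nat.clog 2 l.length = Nat.clog 2 ((l.length + 1) / 2) + 1 := by
      rw [Nat.clog_of_two_le one_lt_two hn]
      rfl
    have h₁ : Nat.clog 2 (l.take (l.length / 2)).length ≤ Nat.clog 2 ((l.length + 1) / 2) :=
      Nat.clog_mono_right 2 (by simp; omega)
    have h₂ : Nat.clog 2 (l.drop (l.length / 2)).length ≤ Nat.clog 2 ((l.length + 1) / 2) :=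
      Nat.clog_mono_right 2 (by simp; omega)
    have l_sum : (l.take (l.length / 2)).length + (l.drop (l.length / 2)).length = l.length := by
      rw [← List.length_append, List.take_append_drop]
    rw [h_clog]
    simp only [Timed.cost_bind, Timed.cost_tick]
    generalize Nat.clog 2 ((l.length + 1) / 2) = D at *
    generalize (l.take (l.length / 2)).length = n₁ at *
    generalize (l.drop (l.length / 2)).length = n₂ at *
    generalize ((l.take (l.length / 2)).map w).sum = S₁ at *
    generalize ((l.drop (l.length / 2)).map w).sum = S₂ at *
    have e₁ := Nat.mul_le_mul_left ((K + 3) * (S₁ + n₁)) h₁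
    have e₂ := Nat.mul_le_mul_left ((K + 3) * (S₂ + n₂)) h₂
    generalize divideConquer empty leaf combine (l.take (l.length / 2)) = y₁ at *
    generalize divideConquer empty leaf combine (l.drop (l.length / 2)) = y₂ at *
    -- The length, at least 2 here, pays for the `+ 1` in the combination cost.
    have e₃ := Nat.mul_le_mul_left K (show size y₁.val + size y₂.val + 1
      ≤ (l.map w).sum + l.length by omega)
    rw [← h_sum, ← l_sum] at e₃ ⊢
    have e₄ : (K + 3) * (S₁ + S₂ + (n₁ + n₂)) * (D + 1)
      = (K + 3) * (S₁ + n₁) * D + (K + 3) * (S₂ + n₂) * D + K * (S₁ + S₂ + (n₁ + n₂))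
        + 3 * (S₁ + S₂ + (n₁ + n₂)) := by ring
    omega

theorem merge_perm (le : X → X → Timed Bool) (xs ys : List X) :
    (merge le xs ys).val.Perm (xs ++ ys) := by
  induction xs, ys using merge.induct with
  | case1 ys => simp [merge]
  | case2 x xs => simp [merge]
  | case3 x xs y ys ih₁ ih₂ =>
    rw [merge]
    simp only [Timed.val_bind, Timed.val_ite, Timed.val_pure]
    split_ifs with h
    · simpa using ih₁
    · refine (ih₂.cons y).trans ?_
      exact (List.perm_middle (l₁ := x :: xs)).symm

theorem merge_length (le : X → X → Timed Bool) (xs ys : List X) :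
    (merge le xs ys).val.length = xs.length + ys.length := by
  rw [(merge_perm le xs ys).length_eq, List.length_append]

theorem merge_cost {le : X → X → Timed Bool} {κ : ℕ} (h : ∀ x y, (le x y).cost ≤ κ)
    (xs ys : List X) :
    (merge le xs ys).cost ≤ (κ + 1) * (xs.length + ys.length + 1) := by
  induction xs, ys using merge.induct with
  | case1 ys => simp [merge]; nlinarith
  | case2 x xs => simp [merge]; nlinarith
  | case3 x xs y ys ih₁ ih₂ =>
    rw [merge]
    have := h x y
    simp only [Timed.cost_bind, Timed.cost_ite, Timed.cost_pure, Timed.cost_tick,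
      List.length_cons] at *
    split_ifs <;> nlinarith

theorem mergeSort_perm (le : X → X → Timed Bool) (l : List X) : (mergeSort le l).val.Perm l := by
  refine divideConquer_induction (motive := fun (l y : List X) => y.Perm l) (List.Perm.refl _)
    (fun x => List.Perm.refl _) ?_ l
  intro l₁ l₂ y₁ y₂ h₁ h₂
  exact (merge_perm le y₁ y₂).trans (h₁.append h₂)

theorem mergeSort_cost {le : X → X → Timed Bool} {κ : ℕ} (h : ∀ x y, (le x y).cost ≤ κ)
    (l : List X) :
    (mergeSort le l).cost
      ≤ (2 * κ + 8) * l.length * Nat.clog 2 l.length + 2 * l.length + 1 := by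
  have := divideConquer_cost (empty := []) (leaf := fun x => [x]) (combine := merge le)
    (fun _ => 1) List.length rfl (by simp) (fun y₁ y₂ => (merge_length le y₁ y₂).le) _ (κ + 1)
    (fun y₁ y₂ _ => merge_cost h y₁ y₂) l le_rfl
  simp only [List.map_const', List.sum_replicate, smul_eq_mul, mul_one] at this
  refine this.trans (le_of_eq ?_)
  ring

end Generic

/-! ### Cost of the multidimensional divide-and-conquer skyline algorithm. -/

section Algorithms

variable {α : Type} [LinearOrder α] {d : ℕ}

@[simp] theorem leAt_val (i : Fin d) (p q : Fin d → α) : (leAt i p q).val = decide (p i ≤ q i) :=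
  rfl

@[simp] theorem leAt_cost (i : Fin d) (p q : Fin d → α) : (leAt i p q).cost = 1 := rfl

theorem lexLe_cost (is : List (Fin d)) (p q : Fin d → α) :
    (lexLe is p q).cost ≤ 3 * is.length + 1 := by
  induction is with
  | nil => simp [lexLe]
  | cons i is ih =>
    simp only [lexLe, Timed.cost_bind, Timed.cost_ite, Timed.cost_pure, Timed.cost_tick,
      leAt_cost, List.length_cons]
    split_ifs <;> omega

theorem eqOn_cost (is : List (Fin d)) (p q : Fin d → α) :
    (eqOn is p q).cost ≤ 3 * is.length + 1 := by
  induction is with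
  | nil => simp [eqOn]
  | cons i is ih =>
    simp only [eqOn, Timed.cost_bind, Timed.cost_ite, Timed.cost_pure, Timed.cost_tick,
      leAt_cost, List.length_cons]
    split_ifs <;> omega

@[simp] theorem coveredBy_cost (j : Fin d) (best : Option (Fin d → α)) (b : Fin d → α) :
    (coveredBy j best b).cost = 1 := by
  cases best <;> simp [coveredBy]

theorem sweep_length (c j : Fin d) (best : Option (Fin d → α)) (A B : List (Fin d → α)) :
    (sweep c j best A B).val.length ≤ B.length := by
  induction best, A, B using sweep.induct with
  | case1 => simp [sweep]
  | case2 best b bs ih =>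
    simp only [sweep, Timed.val_bind, Timed.val_ite, Timed.val_pure, List.length_cons]
    split_ifs
    · omega
    · simpa using ih
  | case3 best a as b bs ih₁ ih₂ =>
    rw [sweep]
    simp only [Timed.val_bind, Timed.val_ite, Timed.val_pure, List.length_cons] at *
    split_ifs <;> simp_all; omega

theorem sweep_cost (c j : Fin d) (best : Option (Fin d → α)) (A B : List (Fin d → α)) :
    (sweep c j best A B).cost ≤ 3 * (A.length + B.length + 1) := by
  induction best, A, B using sweep.induct with
  | case1 => simp [sweep]; omega
  | case2 best b bs ih =>
    simp only [sweep, Timed.cost_bind, Timed.cost_ite, Timed.cost_pure, Timed.cost_tick,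
      coveredBy_cost, List.length_cons, List.length_nil] at *
    split_ifs <;> omega
  | case3 best a as b bs ih₁ ih₂ =>
    rw [sweep]
    simp only [Timed.cost_bind, Timed.cost_ite, Timed.cost_pure, Timed.cost_tick,
      coveredBy_cost, leAt_cost, List.length_cons] at *
    split_ifs <;> simp_all <;> omega

@[simp] theorem tagLe_cost (k : Fin d) (x y : (Fin d → α) ⊕ (Fin d → α)) :
    (tagLe k x y).cost = 1 := by
  rcases x with x | x <;> rcases y with y | y <;> simp [tagLe]

/-- The combination step of `cross`. -/
def crossCombine (c : Fin d) (is : List (Fin d))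
    (x y : List (Fin d → α) × List (Fin d → α)) :
    Timed (List (Fin d → α) × List (Fin d → α)) := do
  let B₂ ← cross c is x.1 y.2
  let A' ← merge (leAt c) x.1 y.1
  let B' ← merge (leAt c) x.2 B₂
  pure (A', B')

theorem cross_cons_cons (c k j : Fin d) (ks : List (Fin d)) (A B : List (Fin d → α)) :
    cross c (k :: j :: ks) A B = (do
      tick (1 + 2 * (A.length + B.length))
      let L ← mergeSort (tagLe k) (A.map Sum.inl ++ B.map Sum.inr)
      let AB ← divideConquer ([], []) untagSingle (crossCombine c (j :: ks)) L
      pure AB.2) := by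
  rw [cross]
  rfl

theorem crossCombine_length_snd {c : Fin d} {is : List (Fin d)}
    (h : ∀ A B : List (Fin d → α), (cross c is A B).val.length ≤ B.length)
    (x y : List (Fin d → α) × List (Fin d → α)) :
    (crossCombine c is x y).val.2.length ≤ x.2.length + y.2.length := by
  have := h x.1 y.2
  simp only [crossCombine, Timed.val_bind, Timed.val_pure, merge_length]
  omega

theorem crossCombine_length {c : Fin d} {is : List (Fin d)}
    (h : ∀ A B : List (Fin d → α), (cross c is A B).val.length ≤ B.length)
    (x y : List (Fin d → α) × List (Fin d → α)) :
    (crossCombine c is x y).val.1.length + (crossCombine c is x y).val.2.length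
      ≤ (x.1.length + x.2.length) + (y.1.length + y.2.length) := by
  have := h x.1 y.2
  simp only [crossCombine, Timed.val_bind, Timed.val_pure, merge_length]
  omega

theorem cross_length (c : Fin d) (is : List (Fin d)) (A B : List (Fin d → α)) :
    (cross c is A B).val.length ≤ B.length := by
  induction is generalizing A B with
  | nil => rw [cross]; exact sweep_length _ _ _ _ _
  | cons k ks ih =>
    cases ks with
    | nil => rw [cross]; exact sweep_length _ _ _ _ _
    | cons j ks =>
      rw [cross_cons_cons]
      simp only [Timed.val_bind, Timed.val_pure]
      -- Tuples marked `inl` get weight 0, so the total weight is the length of `B` alone.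
      refine (divideConquer_size (Sum.elim (fun _ => 0) (fun _ => 1)) (fun y : List (Fin d → α) × List (Fin d → α) => y.2.length) rfl
        (by rintro (x | x) <;> simp [untagSingle]) (crossCombine_length_snd ih) _).trans ?_
      rw [((mergeSort_perm (tagLe k) _).map _).sum_eq]
      simp [Function.comp_def]

/-- Induction on the attributes: each one beyond the first adds one layer of divide and conquer,
hence one factor `L`. The bound `L` on the logarithm of the input size stays fixed through the
recursion, so that subproblems share one rate. The truncated exponent reflects that zero and one
attribute besides `c` are both handled by a linear sweep. -/
theorem cross_cost (c : Fin d) (is : List (Fin d)) :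
    ∃ C : ℕ, ∀ (A B : List (Fin d → α)) (L : ℕ), 1 ≤ L → Nat.clog 2 (A.length + B.length) ≤ L →
      (cross c is A B).cost ≤ C * L ^ (is.length - 1) * (A.length + B.length + 1) := by
  induction is with
  | nil =>
    refine ⟨3, fun A B L _ _ => ?_⟩
    rw [cross]
    simpa using sweep_cost c c none A B
  | cons k ks ih =>
    cases ks with
    | nil =>
      refine ⟨3, fun A B L _ _ => ?_⟩
      rw [cross]
      simpa using sweep_cost c k none A B
    | cons j ks =>
      obtain ⟨C, hC⟩ := ih
      refine ⟨2 * C + 40, fun A B L hL1 hL => ?_⟩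
      rw [cross_cons_cons]
      have hM := mergeSort_cost (le := tagLe k) (κ := 1) (fun x y => (tagLe_cost k x y).le)
        (A.map Sum.inl ++ B.map Sum.inr)
      have hp := mergeSort_perm (tagLe k) (A.map Sum.inl ++ B.map Sum.inr)
      have h_len : (A.map Sum.inl ++ B.map Sum.inr : List ((Fin d → α) ⊕ (Fin d → α))).length
          = A.length + B.length := by simp
      set M := (mergeSort (tagLe k) (A.map Sum.inl ++ B.map Sum.inr)).val with hM_def
      have h_lenM : M.length = A.length + B.length := by rw [hp.length_eq, h_len]
      have hD := divideConquer_cost (empty := (([], []) : List (Fin d → α) × List (Fin d → α)))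
        (leaf := untagSingle) (combine := crossCombine c (j :: ks)) (fun _ => 1)
        (fun y => y.1.length + y.2.length) rfl
        (by rintro (x | x) <;> simp [untagSingle])
        (crossCombine_length (cross_length c (j :: ks)))
        -- The recursive filtering contributes `C * L ^ ks.length`; each of the two merges has rate
        -- 2.
        (A.length + B.length) (C * L ^ ks.length + 4) (by
          intro x y hxy
          have h1 := hC x.1 y.2 L hL1 ((Nat.clog_mono_right 2 (by omega)).trans hL)
          have h2 := merge_cost (le := leAt c) (κ := 1) (fun x y => (leAt_cost c x y).le) x.1 y.1
          have h3 := merge_cost (le := leAt c) (κ := 1) (fun x y => (leAt_cost c x y).le) x.2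
            (cross c (j :: ks) x.1 y.2).val
          have h4 := cross_length c (j :: ks) x.1 y.2
          simp only [crossCombine, Timed.cost_bind, Timed.cost_pure]
          simp only [List.length_cons, Nat.add_sub_cancel] at h1
          have h5 := Nat.mul_le_mul_left (C * L ^ ks.length) (show x.1.length + y.2.length + 1
            ≤ x.1.length + x.2.length + (y.1.length + y.2.length) + 1 by omega)
          rw [add_mul (C * L ^ ks.length) 4]
          omega) M (by simp [h_lenM])
      simp only [Timed.cost_bind, Timed.cost_pure, Timed.cost_tick, List.length_cons,
        Nat.add_sub_cancel]
      simp only [List.map_const', List.sum_replicate, smul_eq_mul, mul_one, h_lenM, h_len]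
        at hD hM
      rw [← hM_def]
      generalize A.length + B.length = n at *
      have hP : 1 ≤ L ^ ks.length := Nat.one_le_pow _ _ hL1
      rw [pow_succ]
      generalize L ^ ks.length = P at *
      have a₁ : (2 + 8) * n * Nat.clog 2 n ≤ 10 * n * (P * L) := by
        refine Nat.mul_le_mul le_rfl (hL.trans ?_)
        nlinarith
      have a₂ : (C * P + 4 + 3) * (n + n) * Nat.clog 2 n ≤ (2 * C + 14) * n * (P * L) := by
        calc _ ≤ (C * P + 4 + 3) * (n + n) * L := Nat.mul_le_mul le_rfl hL
          _ ≤ (C * P + 7 * P) * (n + n) * L := by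
            have : C * P + 4 + 3 ≤ C * P + 7 * P := by omega
            gcongr
          _ = _ := by ring
      have a₃ : n + 1 ≤ (P * L) * (n + 1) := Nat.le_mul_of_pos_left _ (by positivity)
      have a₄ : (2 * C + 40) * (P * L) * (n + 1) = 10 * n * (P * L) + (2 * C + 14) * n * (P * L)
        + (2 * C + 40) * (P * L) + 16 * (P * L * n) := by ring
      have a₅ : 1 ≤ P * L := Nat.mul_pos hP hL1
      have a₆ : n ≤ P * L * n := Nat.le_mul_of_pos_left _ a₅
      have a₇ : 40 * (P * L) ≤ (2 * C + 40) * (P * L) := by gcongr; omega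
      omega

theorem group_length (is : List (Fin d)) (P : List (Fin d → α)) :
    (group is P).val.length ≤ P.length := by
  induction P with
  | nil => simp [group]
  | cons p ps ih =>
    simp only [group, Timed.val_bind, List.length_cons]
    split
    · rename_i q g gs' h
      rw [h] at ih
      simp only [Timed.val_bind, Timed.val_ite, Timed.val_pure]
      split_ifs <;> simp_all; omega
    · simpa using ih

/-- With the group lengths as weights, the total weight in the recursion over groups is the number
of tuples, however many duplicates occur. -/
theorem group_size (is : List (Fin d)) (P : List (Fin d → α)) :
    ((group is P).val.map List.length).sum = P.length := by
  induction P with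
  | nil => simp [group]
  | cons p ps ih =>
    simp only [group, Timed.val_bind, List.length_cons]
    split
    · rename_i q g gs' h
      rw [h] at ih
      simp only [Timed.val_bind, Timed.val_ite, Timed.val_pure]
      split_ifs <;> simp_all <;> omega
    · simp [ih, add_comm]

theorem group_cost (is : List (Fin d)) (P : List (Fin d → α)) :
    (group is P).cost ≤ (3 * is.length + 2) * (P.length + 1) := by
  induction P with
  | nil => simp [group]
  | cons p ps ih =>
    simp only [group, Timed.cost_bind, Timed.cost_tick, List.length_cons]
    split
    · rename_i q g gs' h
      have := eqOn_cost is p q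
      simp only [Timed.cost_bind, Timed.cost_ite, Timed.cost_pure, ite_self]
      nlinarith
    · simp only [Timed.cost_pure]
      nlinarith

/-- The filtering at each node costs `L ^ (ks.length - 1)` per tuple; the outer recursion supplies
the factor written as the separate `+ 1`. Sorting and grouping are of no larger order. -/
theorem skyDCAux_cost (c k : Fin d) (ks : List (Fin d)) :
    ∃ C : ℕ, ∀ (P : List (Fin d → α)) (L : ℕ), 1 ≤ L → Nat.clog 2 P.length ≤ L →
      (skyDCAux c k ks P).cost ≤ C * L ^ (ks.length - 1 + 1) * (P.length + 1) := by
  obtain ⟨C, hC⟩ := cross_cost (α := α) c ks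
  obtain ⟨κ, hκ⟩ : ∃ κ, κ = 3 * (k :: c :: ks).length + 1 := ⟨_, rfl⟩
  refine ⟨2 * C + 4 * κ + 40, fun P L hL1 hL => ?_⟩
  have hM := mergeSort_cost (le := lexLe (k :: c :: ks)) (κ := κ)
    (fun x y => (lexLe_cost (k :: c :: ks) x y).trans hκ.ge) P
  set M := (mergeSort (lexLe (k :: c :: ks)) P).val with hM_def
  have h_lenM : M.length = P.length := (mergeSort_perm _ _).length_eq
  have hG := group_cost (k :: c :: ks) M
  have hG₁ := group_length (k :: c :: ks) M
  have hG₂ := group_size (k :: c :: ks) M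
  rw [h_lenM] at hG hG₁ hG₂
  set G := (group (k :: c :: ks) M).val with hG_def
  have hD := divideConquer_cost (empty := ([] : List (Fin d → α))) (leaf := fun g => g)
    (combine := fun R₁ R₂ => do
      let R₂' ← cross c ks R₁ R₂
      merge (leAt c) R₁ R₂') List.length List.length rfl (fun _ => le_rfl)
    (by
      intro x y
      have := cross_length c ks x y
      simp only [Timed.val_bind, merge_length]
      omega) P.length (C * L ^ (ks.length - 1) + 2) (by
      intro x y hxy
      have h1 := hC x y L hL1 ((Nat.clog_mono_right 2 hxy).trans hL)
      have h3 := merge_cost (le := leAt c) (κ := 1) (fun x y => (leAt_cost c x y).le) x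
        (cross c ks x y).val
      have h4 := cross_length c ks x y
      simp only [Timed.cost_bind]
      rw [add_mul (C * L ^ (ks.length - 1)) 2]
      omega) G hG₂.le
  have hκ' : 3 * (k :: c :: ks).length + 2 = κ + 1 := by omega
  simp only [skyDCAux, Timed.cost_bind]
  rw [← hM_def, ← hG_def]
  rw [hG₂] at hD
  have hP : 1 ≤ L ^ (ks.length - 1) := Nat.one_le_pow _ _ hL1
  rw [pow_succ]
  have hcl : Nat.clog 2 G.length ≤ L := (Nat.clog_mono_right 2 hG₁).trans hL
  generalize L ^ (ks.length - 1) = Q at *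
  generalize G.length = g at *
  generalize P.length = n at *
  have a₅ : 1 ≤ Q * L := Nat.mul_pos hP hL1
  have a₁ : (2 * κ + 8) * n * Nat.clog 2 n ≤ (2 * κ + 8) * n * (Q * L) := by
    refine Nat.mul_le_mul le_rfl (hL.trans ?_)
    nlinarith
  have a₂ : (C * Q + 2 + 3) * (n + g) * Nat.clog 2 g ≤ (2 * C + 10) * n * (Q * L) := by
    calc _ ≤ (C * Q + 2 + 3) * (n + n) * L := by gcongr
      _ ≤ (C * Q + 5 * Q) * (n + n) * L := by
        have : C * Q + 2 + 3 ≤ C * Q + 5 * Q := by omega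
        gcongr
      _ = _ := by ring
  have a₃ : (3 * (k :: c :: ks).length + 2) * (n + 1) ≤ (κ + 1) * (Q * L) * (n + 1) := by
    rw [hκ']
    gcongr
    exact Nat.le_mul_of_pos_right _ a₅
  have a₄ : (2 * C + 4 * κ + 40) * (Q * L) * (n + 1) = (2 * κ + 8) * n * (Q * L)
    + (2 * C + 10) * n * (Q * L) + (κ + 1) * (Q * L) * (n + 1)
    + (κ + 21) * (Q * L * n) + (2 * C + 3 * κ + 39) * (Q * L) := by ring
  have a₆ : n ≤ Q * L * n := Nat.le_mul_of_pos_left _ a₅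
  have a₇ : 39 * (Q * L) ≤ (2 * C + 3 * κ + 39) * (Q * L) := by gcongr; omega
  have a₈ : 21 * (Q * L * n) ≤ (κ + 21) * (Q * L * n) := by gcongr; omega
  omega

theorem skyDC_cost (hd : 2 ≤ d) :
    ∃ C : ℕ, ∀ (P : List (Fin d → α)) (L : ℕ), 1 ≤ L → Nat.clog 2 P.length ≤ L →
      (skyDC P).cost ≤ C * L ^ max (d - 2) 1 * (P.length + 1) := by
  have h_len : (List.finRange d).length = d := List.length_finRange
  unfold skyDC
  rcases h : List.finRange d with _ | ⟨c, _ | ⟨k, ks⟩⟩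
  · simp [h] at h_len; omega
  · simp [h] at h_len; omega
  · obtain ⟨C, hC⟩ := skyDCAux_cost (α := α) c k ks
    -- Here `ks` has d - 2 elements; truncated subtraction produces the exponent 1 when d = 2.
    have : max (d - 2) 1 = ks.length - 1 + 1 := by
      simp only [h, List.length_cons] at h_len
      omega
    exact ⟨C, by simpa only [this] using hC⟩

end Algorithms

/-! ### Powers of the logarithm -/

/-- A single term of the exponential series at `c * x` already dominates. -/
theorem exists_pow_le_mul_exp (N : ℕ) {c : ℝ} (hc : 0 < c) :
    ∃ C : ℝ, 0 < C ∧ ∀ x : ℝ, 0 ≤ x → x ^ N ≤ C * Real.exp (c * x) := by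
  refine ⟨N.factorial / c ^ N, by positivity, fun x hx => ?_⟩
  have h := Real.pow_div_factorial_le_exp (c * x) (by positivity) N
  have hN : (0 : ℝ) < N.factorial := by positivity
  rw [div_le_iff₀ hN, mul_pow] at h
  rw [div_mul_eq_mul_div, le_div_iff₀ (by positivity)]
  linarith

theorem exists_log_pow_le (N : ℕ) :
    ∃ C : ℕ, ∀ m : ℕ, 1 ≤ m → (Nat.log 2 m + 1) ^ N ≤ C * m := by
  obtain ⟨C, _, h⟩ := exists_pow_le_mul_exp N (Real.log_pos one_lt_two)
  refine ⟨⌈2 * C⌉₊, fun m hm => ?_⟩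
  have h₁ := h ((Nat.log 2 m + 1 : ℕ) : ℝ) (by positivity)
  rw [mul_comm (Real.log 2), Real.exp_nat_mul, Real.exp_log two_pos] at h₁
  have h₂ : (2 : ℝ) ^ (Nat.log 2 m + 1) ≤ 2 * m := by
    have := Nat.pow_log_le_self 2 (x := m) (by omega)
    have : 2 ^ (Nat.log 2 m + 1) ≤ 2 * m := by rw [pow_succ]; omega
    exact_mod_cast this
  have h₃ : ((Nat.log 2 m + 1 : ℕ) : ℝ) ^ N ≤ (⌈2 * C⌉₊ : ℝ) * m := by
    calc _ ≤ C * 2 ^ (Nat.log 2 m + 1) := h₁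
      _ ≤ C * (2 * m) := by gcongr
      _ = (2 * C) * m := by ring
      _ ≤ _ := by gcongr; exact Nat.le_ceil _
  exact_mod_cast h₃

theorem clog_le_log_succ (n : ℕ) : Nat.clog 2 n ≤ Nat.log 2 n + 1 :=
  Nat.clog_le_of_le_pow (Nat.lt_pow_succ_log_self one_lt_two n).le

/-! ### Linear search -/

section Search

variable {d : ℕ} {p : ℕ → Bool}

theorem le_search (fuel k : ℕ) : k ≤ (search d p fuel k).val := by
  induction fuel generalizing k with
  | zero => simp [search]
  | succ fuel ih =>
    simp only [search, Timed.val_bind, Timed.val_ite, Timed.val_pure]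
    split_ifs
    · exact le_rfl
    · exact (Nat.le_succ k).trans (ih _)

theorem search_le {fuel k j : ℕ} (hkj : k ≤ j) (hj : j ≤ k + fuel) (hp : p j) :
    (search d p fuel k).val ≤ j := by
  induction fuel generalizing k with
  | zero => simpa [search] using hkj
  | succ fuel ih =>
    simp only [search, Timed.val_bind, Timed.val_ite, Timed.val_pure]
    split_ifs with h
    · exact hkj
    · have : k ≠ j := by rintro rfl; exact h hp
      exact ih (Nat.lt_of_le_of_ne hkj this) (by omega)

/-- When the fuel runs out, `k + fuel` is returned untested; the hypothesis covers this case. -/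
theorem search_spec {fuel k : ℕ} (hp : p (k + fuel)) : p (search d p fuel k).val := by
  induction fuel generalizing k with
  | zero => simpa [search] using hp
  | succ fuel ih =>
    simp only [search, Timed.val_bind, Timed.val_ite, Timed.val_pure]
    split_ifs with h
    · exact h
    · exact ih (by rwa [show k + 1 + fuel = k + (fuel + 1) by omega])

theorem not_of_lt_search {fuel k j : ℕ} (hkj : k ≤ j) (hj : j < (search d p fuel k).val) :
    p j = false := by
  induction fuel generalizing k with
  | zero => simp [search] at hj; omega
  | succ fuel ih =>
    simp only [search, Timed.val_bind, Timed.val_ite, Timed.val_pure] at hj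
    split_ifs at hj with h
    · omega
    · rcases hkj.eq_or_lt with rfl | hlt
      · simpa using h
      · exact ih hlt hj

theorem search_cost (fuel k : ℕ) :
    (search d p fuel k).cost
      ≤ ((search d p fuel k).val + 1 - k) * ((search d p fuel k).val + 2 * d + 1) + 1 := by
  induction fuel generalizing k with
  | zero => simp [search]
  | succ fuel ih =>
    simp only [search, Timed.val_bind, Timed.val_ite, Timed.val_pure, Timed.cost_bind,
      Timed.cost_ite, Timed.cost_pure, Timed.cost_tick]
    split_ifs
    · have : k + 1 - k = 1 := by omega
      rw [this]
      omega
    · have h₁ := ih (k + 1)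
      have h₂ := le_search (d := d) (p := p) fuel (k + 1)
      generalize search d p fuel (k + 1) = v at *
      have : v.val + 1 - k = (v.val + 1 - (k + 1)) + 1 := by omega
      rw [this, add_mul]
      omega

theorem search_log (n : ℕ) :
    (search d (fun l => decide (n < 2 ^ (l + 1))) n 0).val = Nat.log 2 n := by
  apply le_antisymm
  · refine search_le (Nat.zero_le _) ?_ ?_
    · rw [zero_add]; exact Nat.log_le_self 2 n
    · simpa using Nat.lt_pow_succ_log_self one_lt_two n
  · have h := search_spec (d := d) (p := fun l => decide (n < 2 ^ (l + 1))) (fuel := n) (k := 0)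
      (by
        simp only [zero_add, decide_eq_true_eq]
        exact (Nat.lt_two_pow_self).trans (Nat.pow_lt_pow_right one_lt_two (Nat.lt_succ_self n)))
    simp only [decide_eq_true_eq] at h
    exact Nat.lt_succ_iff.mp (Nat.log_lt_of_lt_pow' (Nat.succ_ne_zero _) h)

theorem search_sqrt (n : ℕ) :
    (search d (fun s => decide (n < (s + 1) ^ 2)) n 0).val = Nat.sqrt n := by
  apply le_antisymm
  · refine search_le (Nat.zero_le _) ?_ ?_
    · rw [zero_add]; exact Nat.sqrt_le_self n
    · simpa using Nat.lt_succ_sqrt' n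
  · have h := search_spec (d := d) (p := fun s => decide (n < (s + 1) ^ 2)) (fuel := n) (k := 0)
      (by
        simp only [zero_add, decide_eq_true_eq]
        nlinarith)
    simp only [decide_eq_true_eq] at h
    exact Nat.lt_succ_iff.mp (Nat.sqrt_lt'.mpr h)

end Search

/-- The order of the empirical quantiles that are used by `flet`. -/
def quantileOrder (d n : ℕ) : ℕ :=
  (search d (fun k => decide (n.sqrt ^ d * Nat.log 2 n ≤ k ^ d * n)) n.sqrt 1).val

theorem one_le_quantileOrder (d n : ℕ) : 1 ≤ quantileOrder d n := le_search _ _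

theorem quantileOrder_le {d n : ℕ} (hn : 1 ≤ n) : quantileOrder d n ≤ n.sqrt := by
  refine search_le (Nat.sqrt_pos.mpr hn) (Nat.le_add_left _ _) ?_
  simpa using Nat.mul_le_mul_left _ (Nat.log_le_self 2 n)

/-- In other words (k/s)^d ≥ ⌊log₂ n⌋ / n: a box whose sides have measure comparable to k/s is
likely to contain one of n tuples. -/
theorem le_quantileOrder_pow {d n : ℕ} :
    n.sqrt ^ d * Nat.log 2 n ≤ quantileOrder d n ^ d * n := by
  have h := search_spec (d := d)
    (p := fun k => decide (n.sqrt ^ d * Nat.log 2 n ≤ k ^ d * n)) (fuel := n.sqrt) (k := 1)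
    (by
      simp only [decide_eq_true_eq]
      gcongr
      · omega
      · exact Nat.log_le_self 2 n)
  exact of_decide_eq_true h

theorem quantileOrder_pred_pow_lt {d n j : ℕ} (hj : 1 ≤ j) (hlt : j < quantileOrder d n) :
    j ^ d * n < n.sqrt ^ d * Nat.log 2 n := by
  simpa using not_of_lt_search hj hlt

section Flet

variable {α : Type} [LinearOrder α] {d : ℕ}

/-! ### The virtual tuple and the scan -/

theorem merge_leAt_pairwise (i : Fin d) (xs ys : List (Fin d → α))
    (hx : xs.Pairwise (fun p q => p i ≤ q i)) (hy : ys.Pairwise (fun p q => p i ≤ q i)) :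
    (merge (leAt i) xs ys).val.Pairwise (fun p q => p i ≤ q i) := by
  induction xs, ys using merge.induct with
  | case1 ys => simpa [merge] using hy
  | case2 x xs => simpa [merge] using hx
  | case3 x xs y ys ih₁ ih₂ =>
    rw [merge]
    simp only [Timed.val_bind, Timed.val_ite, Timed.val_pure, leAt_val, decide_eq_true_eq]
    have hx' := List.pairwise_cons.mp hx
    have hy' := List.pairwise_cons.mp hy
    split_ifs with h
    · refine List.pairwise_cons.mpr ⟨fun z hz => ?_, ih₁ hx'.2 hy⟩
      rcases List.mem_append.mp ((merge_perm _ _ _).mem_iff.mp hz) with hz | hz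
      · exact hx'.1 z hz
      · rcases List.mem_cons.mp hz with rfl | hz
        · exact h
        · exact h.trans (hy'.1 z hz)
    · have h := (not_le.mp h).le
      refine List.pairwise_cons.mpr ⟨fun z hz => ?_, ih₂ hx hy'.2⟩
      rcases List.mem_append.mp ((merge_perm _ _ _).mem_iff.mp hz) with hz | hz
      · rcases List.mem_cons.mp hz with rfl | hz
        · exact h
        · exact h.trans (hx'.1 z hz)
      · exact hy'.1 z hz

theorem mergeSort_leAt_pairwise (i : Fin d) (l : List (Fin d → α)) :
    (mergeSort (leAt i) l).val.Pairwise (fun p q => p i ≤ q i) := by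
  refine divideConquer_induction
    (motive := fun _ (y : List (Fin d → α)) => y.Pairwise (fun p q => p i ≤ q i))
    List.Pairwise.nil (fun _ => List.pairwise_singleton _ _) ?_ l
  intro _ _ y₁ y₂ h₁ h₂
  exact merge_leAt_pairwise i y₁ y₂ h₁ h₂

open scoped Classical in
/-- The `k`-th smallest value belongs to a lower set if and only if at least `k` values do. -/
theorem mem_lowerSet_iff_le_countP {X : Type} {f : X → α} {L : List X}
    (hL : L.Pairwise (fun p q => f p ≤ f q)) {k : ℕ} (hk : 1 ≤ k) {w : X} {rest : List X}
    (hw : L.drop (k - 1) = w :: rest) {D : Set α} (hD : IsLowerSet D) :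
    f w ∈ D ↔ k ≤ L.countP (fun p => f p ∈ D) := by
  have h_split := List.take_append_drop (k - 1) L
  rw [hw] at h_split
  have h_len : (L.take (k - 1)).length = k - 1 := by
    rw [List.length_take, min_eq_left]
    by_contra! hlt
    rw [List.drop_eq_nil_of_le hlt.le] at hw
    exact List.cons_ne_nil _ _ hw.symm
  generalize L.take (k - 1) = M at *
  subst h_split
  rw [List.pairwise_append, List.pairwise_cons] at hL
  rw [List.countP_append, List.countP_cons]
  constructor
  · intro h
    have : M.countP (fun p => f p ∈ D) = M.length := by
      rw [List.countP_eq_length]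
      intro p hp
      simpa using hD (hL.2.2 p hp w List.mem_cons_self) h
    simp [h, this]
    omega
  · intro h
    by_contra hwD
    have : rest.countP (fun p => f p ∈ D) = 0 := by
      rw [List.countP_eq_zero]
      intro p hp hpD
      exact hwD (hD (hL.2.1.1 p hp) (by simpa using hpD))
    have := M.countP_le_length (p := fun p => decide (f p ∈ D))
    simp [hwD] at h
    omega

-- This turns statements about order statistics into statements about counts, which are sums over
-- independent tuples. Lower sets are used instead of thresholds so that the empty set and the whole
-- line are admitted.
open scoped Classical in
theorem mem_virtualPoint {Q : List (Fin d → α)} {k : ℕ} (hk : 1 ≤ k) {is : List (Fin d)}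
    {x : Fin d × (Fin d → α)} (hx : x ∈ (virtualPoint Q k is).val) {D : Set α}
    (hD : IsLowerSet D) : x.2 x.1 ∈ D ↔ k ≤ Q.countP (fun p => p x.1 ∈ D) := by
  induction is with
  | nil => simp [virtualPoint] at hx
  | cons i is ih =>
    simp only [virtualPoint, Timed.val_bind] at hx
    split at hx
    · rename_i w rest hw
      rcases List.mem_cons.mp hx with rfl | hx
      · rw [← (mergeSort_perm (leAt i) Q).countP_eq]
        exact mem_lowerSet_iff_le_countP (f := fun p => p i) (mergeSort_leAt_pairwise i Q) hk hw hD
      · exact ih hx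
    · exact ih hx

theorem virtualPoint_length (Q : List (Fin d → α)) (k : ℕ) (is : List (Fin d)) :
    (virtualPoint Q k is).val.length ≤ is.length := by
  induction is with
  | nil => simp [virtualPoint]
  | cons i is ih =>
    simp only [virtualPoint, Timed.val_bind]
    split <;> simp <;> omega

theorem virtualPoint_cost (Q : List (Fin d → α)) (k : ℕ) (is : List (Fin d)) :
    (virtualPoint Q k is).cost
      ≤ is.length * (k + 10 * Q.length * Nat.clog 2 Q.length + 2 * Q.length + 2) + 1 := by
  induction is with
  | nil => simp [virtualPoint]
  | cons i is ih =>
    have h := mergeSort_cost (le := leAt i) (κ := 1) (fun x y => (leAt_cost i x y).le) Q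
    simp only [virtualPoint, Timed.cost_bind, Timed.cost_tick, List.length_cons]
    norm_num at h
    rw [add_mul]
    split <;> simp only [Timed.cost_pure] <;> omega

theorem allLe_val (p : Fin d → α) (x : List (Fin d × (Fin d → α))) :
    (allLe p x).val = true ↔ ∀ y ∈ x, p y.1 ≤ y.2 y.1 := by
  induction x with
  | nil => simp [allLe]
  | cons y x ih =>
    obtain ⟨i, w⟩ := y
    simp only [allLe, Timed.val_bind, Timed.val_ite, leAt_val, Timed.val_pure, decide_eq_true_eq,
      List.forall_mem_cons]
    split_ifs with h <;> simp [h, ih]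

theorem allGt_val (p : Fin d → α) (x : List (Fin d × (Fin d → α))) :
    (allGt p x).val = true ↔ ∀ y ∈ x, y.2 y.1 < p y.1 := by
  induction x with
  | nil => simp [allGt]
  | cons y x ih =>
    obtain ⟨i, w⟩ := y
    simp only [allGt, Timed.val_bind, Timed.val_ite, leAt_val, Timed.val_pure, decide_eq_true_eq,
      List.forall_mem_cons]
    split_ifs with h
    · simp [not_lt.mpr h]
    · simp [not_le.mp h, ih]

theorem allLe_cost (p : Fin d → α) (x : List (Fin d × (Fin d → α))) :
    (allLe p x).cost ≤ 2 * x.length + 1 := by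
  induction x with
  | nil => simp [allLe]
  | cons y x ih =>
    obtain ⟨i, w⟩ := y
    simp only [allLe, Timed.cost_bind, Timed.cost_ite, leAt_cost, Timed.cost_pure, Timed.cost_tick,
      List.length_cons]
    split_ifs <;> omega

theorem allGt_cost (p : Fin d → α) (x : List (Fin d × (Fin d → α))) :
    (allGt p x).cost ≤ 2 * x.length + 1 := by
  induction x with
  | nil => simp [allGt]
  | cons y x ih =>
    obtain ⟨i, w⟩ := y
    simp only [allGt, Timed.cost_bind, Timed.cost_ite, leAt_cost, Timed.cost_pure, Timed.cost_tick,
      List.length_cons]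
    split_ifs <;> omega

theorem scan_fst (x : List (Fin d × (Fin d → α))) (P : List (Fin d → α)) :
    (scan x P).val.1 = true ↔ ∃ p ∈ P, ∀ y ∈ x, p y.1 ≤ y.2 y.1 := by
  induction P with
  | nil => simp [scan]
  | cons p ps ih => simp [scan, allLe_val, ih]

theorem scan_snd (x : List (Fin d × (Fin d → α))) (P : List (Fin d → α)) :
    (scan x P).val.2 = P.filter (fun p => !(allGt p x).val) := by
  induction P with
  | nil => simp [scan]
  | cons p ps ih =>
    simp only [scan, Timed.val_bind, Timed.val_pure, ih, List.filter_cons]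
    cases (allGt p x).val <;> simp

theorem scan_cost (x : List (Fin d × (Fin d → α))) (P : List (Fin d → α)) :
    (scan x P).cost ≤ (4 * x.length + 3) * P.length + 1 := by
  induction P with
  | nil => simp [scan]
  | cons p ps ih =>
    have h₁ := allLe_cost p x
    have h₂ := allGt_cost p x
    simp only [scan, Timed.cost_bind, Timed.cost_pure, Timed.cost_tick, List.length_cons, mul_add]
    omega

/-! ### The running time of FLET -/

/-- The virtual tuple that is used by `flet`. -/
def fletPoint (P : List (Fin d → α)) : List (Fin d × (Fin d → α)) :=
  (virtualPoint (P.take P.length.sqrt) (quantileOrder d P.length) (List.finRange d)).val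

/-- The tuples to which `flet` applies the divide-and-conquer algorithm. -/
def fletRemaining (P : List (Fin d → α)) : List (Fin d → α) :=
  if (scan (fletPoint P) P).val.1 then (scan (fletPoint P) P).val.2 else P

theorem fletRemaining_length_le (P : List (Fin d → α)) : (fletRemaining P).length ≤ P.length := by
  unfold fletRemaining
  split_ifs
  · rw [scan_snd]
    exact List.length_filter_le _ _
  · exact le_rfl

theorem flet_cost_eq (P : List (Fin d → α)) :
    (flet P).cost = 1 + P.length
      + (search d (fun l => decide (P.length < 2 ^ (l + 1))) P.length 0).cost
      + (search d (fun s => decide (P.length < (s + 1) ^ 2)) P.length 0).cost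
      + (search d (fun k => decide (P.length.sqrt ^ d * Nat.log 2 P.length ≤ k ^ d * P.length))
          P.length.sqrt 1).cost
      + P.length.sqrt
      + (virtualPoint (P.take P.length.sqrt) (quantileOrder d P.length) (List.finRange d)).cost
      + (scan (fletPoint P) P).cost
      + (skyDC (fletRemaining P)).cost := by
  by_cases h : (scan (fletPoint P) P).val.1 = true
  · rw [show fletRemaining P = (scan (fletPoint P) P).val.2 from if_pos h]
    simp only [fletPoint, quantileOrder] at h ⊢
    simp only [flet, Timed.cost_bind, Timed.cost_tick, search_log, search_sqrt, if_pos h]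
    ring
  · rw [show fletRemaining P = P from if_neg h]
    simp only [fletPoint, quantileOrder] at h ⊢
    simp only [flet, Timed.cost_bind, Timed.cost_tick, search_log, search_sqrt, if_neg h]
    ring

-- Only the final divide and conquer can exceed linear time. The searches cost O(log² m) or O(s²)
-- with s² ≤ m, and the d sorts of s tuples cost O(s log m). The bound keeps the number of remaining
-- tuples, so it serves both the worst case and the average case.
set_option maxHeartbeats 1000000 in
theorem flet_cost (hd : 2 ≤ d) :
    ∃ C : ℕ, ∀ P : List (Fin d → α), 1 ≤ P.length →
      (flet P).cost ≤
        C * (P.length + (Nat.log 2 P.length + 1) ^ max (d - 2) 1 * (fletRemaining P).length) := by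
  obtain ⟨C₁, h₁⟩ := skyDC_cost (α := α) hd
  obtain ⟨C₂, h₂⟩ := exists_log_pow_le 2
  obtain ⟨C₃, h₃⟩ := exists_log_pow_le (max (d - 2) 1)
  refine ⟨C₁ + (C₂ * (2 * d + 1) + 2 * (4 * d + 8) + d * (5 * (C₂ + 1) + 6) + 20 * d + C₁ * C₃
    + 20), fun P hP => ?_⟩
  rw [flet_cost_eq]
  have e₁ := h₁ (fletRemaining P) (Nat.log 2 P.length + 1) (Nat.le_add_left _ _)
    ((clog_le_log_succ _).trans
      (Nat.add_le_add_right (Nat.log_mono_right (fletRemaining_length_le P)) 1))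
  have e₂ := h₂ P.length hP
  have e₃ := h₃ P.length hP
  have c₁ := search_cost (d := d) (p := fun l => decide (P.length < 2 ^ (l + 1))) P.length 0
  have c₂ := search_cost (d := d) (p := fun s => decide (P.length < (s + 1) ^ 2)) P.length 0
  have c₃ := search_cost (d := d) (p := fun k => decide
    (P.length.sqrt ^ d * Nat.log 2 P.length ≤ k ^ d * P.length)) P.length.sqrt 1
  have c₄ := virtualPoint_cost (P.take P.length.sqrt) (quantileOrder d P.length) (List.finRange d)
  have c₅ := scan_cost (fletPoint P) P
  have hk : (search d (fun k => decide
    (P.length.sqrt ^ d * Nat.log 2 P.length ≤ k ^ d * P.length)) P.length.sqrt 1).val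
      ≤ P.length.sqrt := quantileOrder_le hP
  have hk' := quantileOrder_le (d := d) hP
  have hs : P.length.sqrt ^ 2 ≤ P.length := Nat.sqrt_le' _
  have hs' : P.length.sqrt ≤ P.length := Nat.sqrt_le_self _
  have hx : (fletPoint P).length ≤ d :=
    (virtualPoint_length _ _ _).trans_eq List.length_finRange
  have hQ : (P.take P.length.sqrt).length = P.length.sqrt := by simp [hs']
  have hcl : Nat.clog 2 P.length.sqrt ≤ Nat.log 2 P.length + 1 :=
    (clog_le_log_succ _).trans (Nat.add_le_add_right (Nat.log_mono_right hs') 1)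
  rw [search_log] at c₁
  rw [search_sqrt] at c₂
  rw [hQ, List.length_finRange] at c₄
  generalize (search d (fun k => decide
    (P.length.sqrt ^ d * Nat.log 2 P.length ≤ k ^ d * P.length)) P.length.sqrt 1) = sk at *
  generalize (search d (fun l => decide (P.length < 2 ^ (l + 1))) P.length 0).cost = t₁ at *
  generalize (search d (fun s => decide (P.length < (s + 1) ^ 2)) P.length 0).cost = t₂ at *
  generalize (virtualPoint (P.take P.length.sqrt) (quantileOrder d P.length)
    (List.finRange d)).cost = t₄ at *
  generalize (scan (fletPoint P) P).cost = t₅ at *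
  generalize (skyDC (fletRemaining P)).cost = t₆ at *
  generalize (fletRemaining P).length = r at *
  generalize (fletPoint P).length = lx at *
  generalize quantileOrder d P.length = k at *
  generalize Nat.clog 2 P.length.sqrt = cl at *
  generalize P.length.sqrt = s at *
  generalize P.length = m at *
  generalize Nat.log 2 m = lg at *
  generalize (lg + 1) ^ max (d - 2) 1 = Q at *
  have f₁ : t₁ ≤ C₂ * (2 * d + 1) * m + 1 := by
    calc t₁ ≤ (lg + 1) * (lg + 2 * d + 1) + 1 := by simpa using c₁
      _ ≤ (lg + 1) * ((lg + 1) * (2 * d + 1)) + 1 := by gcongr; nlinarith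
      _ = (lg + 1) ^ 2 * (2 * d + 1) + 1 := by ring
      _ ≤ C₂ * m * (2 * d + 1) + 1 := by gcongr
      _ = _ := by ring
  have f₂ : t₂ ≤ (4 * d + 8) * m + 1 := by
    calc t₂ ≤ (s + 1) * (s + 2 * d + 1) + 1 := by simpa using c₂
      _ = s ^ 2 + (2 * d + 2) * s + (2 * d + 1) + 1 := by ring
      _ ≤ m + (2 * d + 2) * m + (2 * d + 1) * m + 1 := by
        gcongr
        exact Nat.le_mul_of_pos_right _ hP
      _ ≤ _ := by nlinarith
  have f₃ : sk.cost ≤ (4 * d + 8) * m + 1 := by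
    calc sk.cost ≤ (sk.val + 1 - 1) * (sk.val + 2 * d + 1) + 1 := c₃
      _ ≤ s * (s + 2 * d + 1) + 1 := by
        gcongr
        omega
      _ = s ^ 2 + (2 * d + 1) * s + 1 := by ring
      _ ≤ m + (2 * d + 1) * m + 1 := by gcongr
      _ ≤ _ := by nlinarith
  have f₄ : t₄ ≤ d * (5 * (C₂ + 1) + 6) * m + 1 := by
    -- By 2ab ≤ a² + b², with s² ≤ m and (lg + 1)² ≤ C₂ m.
    have h_sl : 2 * (s * (lg + 1)) ≤ (C₂ + 1) * m := by
      have := two_mul_le_add_sq s (lg + 1)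
      nlinarith
    have h_scl : 10 * s * cl ≤ 5 * ((C₂ + 1) * m) := by
      calc 10 * s * cl ≤ 10 * s * (lg + 1) := by gcongr
        _ = 5 * (2 * (s * (lg + 1))) := by ring
        _ ≤ _ := by gcongr
    calc t₄ ≤ d * (k + 10 * s * cl + 2 * s + 2) + 1 := c₄
      _ ≤ d * (m + 5 * ((C₂ + 1) * m) + 2 * m + 2 * m) + 1 := by
        gcongr
        · omega
        · omega
      _ ≤ d * ((5 * (C₂ + 1) + 6) * m) + 1 := by
        gcongr
        linarith
      _ = _ := by ring
  have f₅ : t₅ ≤ (4 * d + 3) * m + 1 := c₅.trans (by gcongr)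
  have f₆ : t₆ ≤ C₁ * (Q * r) + C₁ * C₃ * m := by
    calc t₆ ≤ C₁ * Q * (r + 1) := e₁
      _ = C₁ * (Q * r) + C₁ * Q := by ring
      -- The lone power of the logarithm, present even if r = 0, is absorbed into the linear term.
      _ ≤ C₁ * (Q * r) + C₁ * (C₃ * m) := by gcongr
      _ = _ := by ring
  have : 1 + m + t₁ + t₂ + sk.cost + s + t₄ + t₅ + t₆
      ≤ C₁ * (Q * r) + (C₂ * (2 * d + 1) + 2 * (4 * d + 8) + d * (5 * (C₂ + 1) + 6) + 20 * d
        + C₁ * C₃ + 20) * m := by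
    have g₁ : (C₂ * (2 * d + 1) + 2 * (4 * d + 8) + d * (5 * (C₂ + 1) + 6) + 20 * d
        + C₁ * C₃ + 20) * m = C₂ * (2 * d + 1) * m + 2 * ((4 * d + 8) * m)
        + d * (5 * (C₂ + 1) + 6) * m + 20 * (d * m) + C₁ * C₃ * m + 20 * m := by ring
    have g₂ : (4 * d + 3) * m = 4 * (d * m) + 3 * m := by ring
    omega
  have h_split : ∀ K, C₁ * (Q * r) + K * m ≤ (C₁ + K) * (m + Q * r) := by
    intro K
    rw [mul_add, add_mul, add_mul]
    omega
  exact this.trans (h_split _)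

end Flet

/-! ### Sampling without replacement -/

section Sampling

variable {α : Type} {d n m : ℕ}

theorem sampleLoop_cost (h : m ≤ n) (ρ : Draws n m) (is : List (Fin m)) (T : Fin n → Fin d → α) :
    (sampleLoop h ρ is T).cost = 5 * is.length + 1 := by
  induction is generalizing T with
  | nil => simp [sampleLoop]
  | cons i is ih =>
    simp only [sampleLoop, Timed.cost_bind, Timed.cost_pure, Timed.cost_tick, ih, List.length_cons]
    ring

/-- A partial shuffle outputs the contents of pairwise different cells, which depend only on the
random choices. Here `π` records which cell's original content is held by each cell. -/
theorem exists_sampleLoop_val (h : m ≤ n) (ρ : Draws n m) (is : List (Fin m))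
    (h_is : is.Pairwise (· < ·)) (π : Fin n → Fin n) (b : ℕ) (hb : ∀ i ∈ is, b ≤ (i : ℕ))
    (hπ : Set.InjOn π {c | b ≤ (c : ℕ)}) :
    ∃ l : List (Fin n), l.Nodup ∧ l.length = is.length ∧
      (∀ x ∈ l, ∃ c : Fin n, b ≤ (c : ℕ) ∧ π c = x) ∧
      ∀ T : Fin n → Fin d → α, (sampleLoop h ρ is (T ∘ π)).val = l.map T := by
  induction is generalizing π b with
  | nil => exact ⟨[], by simp [sampleLoop]⟩
  | cons i is ih =>
    rw [List.pairwise_cons] at h_is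
    have hbi := hb i List.mem_cons_self
    have hj : (i : ℕ) + ρ i < n := by have := (ρ i).isLt; omega
    set j : Fin n := ⟨i + ρ i, hj⟩ with hj_def
    have hij : (i : ℕ) ≤ j := by simp [hj_def]
    have h_update : ∀ c : Fin n, c ≠ j →
        Function.update π j (π (Fin.castLE h i)) c = π c := fun c hc =>
      Function.update_of_ne hc _ _
    have h_inj : ∀ c c' : Fin n, b ≤ (c : ℕ) → b ≤ (c' : ℕ) → π c = π c' → c = c' :=
      fun c c' hc hc' e => hπ hc hc' e
    have h_castLE : ((Fin.castLE h i : Fin n) : ℕ) = i := rfl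
    -- Cells up to `i` are now retired. Cell `j` receives the content of cell `i`, whose only other
    -- holder is retired, so the updated map is injective on the cells from `i + 1` on. If `j = i`,
    -- the update changes nothing.
    obtain ⟨l, h_nodup, h_len, h_mem, h_val⟩ := ih h_is.2
      (Function.update π j (π (Fin.castLE h i))) (i + 1) (fun i' hi' => h_is.1 i' hi') (by
        intro c hc c' hc' e
        simp only [Set.mem_ofPred_eq] at hc hc'
        by_cases h₁ : c = j
        · by_cases h₂ : c' = j
          · rw [h₁, h₂]
          · rw [h₁, Function.update_self, h_update c' h₂] at e
            have := congrArg Fin.val (h_inj _ _ (by omega) (by omega) e)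
            omega
        · by_cases h₂ : c' = j
          · rw [h₂, Function.update_self, h_update c h₁] at e
            have := congrArg Fin.val (h_inj _ _ (by omega) (by omega) e)
            omega
          · rw [h_update c h₁, h_update c' h₂] at e
            exact h_inj _ _ (by omega) (by omega) e)
    refine ⟨π j :: l, List.nodup_cons.mpr ⟨fun hl => ?_, h_nodup⟩, by simp [h_len], ?_, ?_⟩
    · obtain ⟨c, hc, e⟩ := h_mem _ hl
      by_cases h₁ : c = j
      · rw [h₁, Function.update_self] at e
        have := congrArg Fin.val (h_inj _ _ (by omega) (by omega) e)
        rw [h₁] at hc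
        omega
      · rw [h_update c h₁] at e
        exact h₁ (h_inj _ _ (by omega) (by omega) e)
    · intro x hx
      rcases List.mem_cons.mp hx with rfl | hx
      · exact ⟨j, by omega, rfl⟩
      · obtain ⟨c, hc, e⟩ := h_mem x hx
        by_cases h₁ : c = j
        · rw [h₁, Function.update_self] at e
          exact ⟨Fin.castLE h i, by omega, e⟩
        · rw [h_update c h₁] at e
          exact ⟨c, by omega, e⟩
    · intro T
      rw [sampleLoop]
      simp only [Timed.val_bind, Timed.val_pure, List.map_cons, Function.comp_apply]
      rw [← hj_def, ← h_val T, Function.comp_update]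

/-- The order of quantifiers matters: `σ` is chosen before `T`, so conditioning on the draws does
not affect the distribution of the tuples. -/
theorem exists_sample_eq_comp (h : m ≤ n) (ρ : Draws n m) :
    ∃ σ : Fin m → Fin n, Function.Injective σ ∧
      ∀ T : Fin n → Fin d → α, (sampleLoop h ρ (List.finRange m) T).val = List.ofFn (T ∘ σ) := by
  obtain ⟨l, h_nodup, h_len, -, h_val⟩ := exists_sampleLoop_val (d := d) (α := α) h ρ
    (List.finRange m) (List.pairwise_lt_finRange m) id 0 (fun _ _ => Nat.zero_le _)
    Function.injective_id.injOn
  rw [List.length_finRange] at h_len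
  refine ⟨fun i => l.get (Fin.cast h_len.symm i), fun i i' e => ?_, fun T => ?_⟩
  · simpa using List.nodup_iff_injective_get.mp h_nodup e
  · rw [← Function.comp_id T, h_val T]
    refine List.ext_getElem (by simp [h_len]) fun i h₁ h₂ => by simp

theorem baseline_cost [LinearOrder α] (h : m ≤ n) (ρ : Draws n m) :
    ∃ σ : Fin m → Fin n, Function.Injective σ ∧ ∀ T : Fin n → Fin d → α,
      (baseline h T ρ).cost = 5 * m + 1 + (flet (List.ofFn (T ∘ σ))).cost := by
  obtain ⟨σ, hσ, h_val⟩ := exists_sample_eq_comp (d := d) (α := α) h ρ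
  refine ⟨σ, hσ, fun T => ?_⟩
  simp [baseline, sampleLoop_cost, h_val]

end Sampling

/-! ### Independent tuples -/

/-- The preimage of a box is a box with the full space in every coordinate missed by `σ`; those
coordinates contribute factors 1. Injectivity prevents two constraints on the same coordinate. -/
theorem measurePreserving_comp_injective {X : Type*} [MeasurableSpace X] (ν : Measure X)
    [IsProbabilityMeasure ν] {ι κ : Type*} [Fintype ι] [Fintype κ] {σ : ι → κ}
    (hσ : Function.Injective σ) :
    MeasurePreserving (fun T : κ → X => T ∘ σ) (Measure.pi fun _ => ν) (Measure.pi fun _ => ν) := by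
  have h_meas : Measurable (fun T : κ → X => T ∘ σ) :=
    measurable_pi_lambda _ fun i => measurable_pi_apply (σ i)
  refine ⟨h_meas, (Measure.pi_eq fun s hs => ?_).symm⟩
  rw [Measure.map_apply h_meas (MeasurableSet.univ_pi hs)]
  have h_pre : (fun T : κ → X => T ∘ σ) ⁻¹' Set.univ.pi s
      = Set.univ.pi (Function.extend σ s fun _ => Set.univ) := by
    ext T
    simp only [Set.mem_preimage, Set.mem_pi, Set.mem_univ, true_imp_iff, Function.comp_apply]
    constructor
    · intro hT j
      by_cases hj : ∃ i, σ i = j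
      · obtain ⟨i, rfl⟩ := hj
        rw [hσ.extend_apply]
        exact hT i
      · rw [Function.extend_apply' _ _ _ hj]
        trivial
    · intro hT i
      have := hT (σ i)
      rwa [hσ.extend_apply] at this
  rw [h_pre, Measure.pi_pi]
  refine (Fintype.prod_of_injective σ hσ _ _ (fun j hj => ?_) fun i => ?_).symm
  · rw [Function.extend_apply' _ _ _ hj]
    exact measure_univ
  · rw [hσ.extend_apply]

/-! ### Quantile sets of atomless distributions. -/

theorem continuous_cdf (μ : Measure ℝ) [IsProbabilityMeasure μ] (hμ : ∀ x, μ {x} = 0) :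
    Continuous (ProbabilityTheory.cdf μ) := by
  refine continuous_iff_continuousAt.mpr fun x => ?_
  rw [(ProbabilityTheory.monotone_cdf μ).continuousAt_iff_leftLim_eq_rightLim,
    StieltjesFunction.rightLim_eq]
  refine le_antisymm ((ProbabilityTheory.monotone_cdf μ).leftLim_le le_rfl) ?_
  have h := (ProbabilityTheory.cdf μ).measure_singleton x
  rw [ProbabilityTheory.measure_cdf, hμ x, eq_comm, ENNReal.ofReal_eq_zero] at h
  linarith

/-- Intermediate value theorem for the distribution function. The values 0 and 1 are treated apart
because the distribution function need not attain them. -/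
theorem exists_isLowerSet_measureReal_eq (μ : Measure ℝ) [IsProbabilityMeasure μ]
    (hμ : ∀ x, μ {x} = 0) {u : ℝ} (h₀ : 0 ≤ u) (h₁ : u ≤ 1) :
    ∃ D : Set ℝ, IsLowerSet D ∧ MeasurableSet D ∧ μ.real D = u := by
  rcases h₀.eq_or_lt with rfl | h₀
  · exact ⟨∅, isLowerSet_empty, MeasurableSet.empty, by simp⟩
  rcases h₁.eq_or_lt with rfl | h₁
  · exact ⟨Set.univ, isLowerSet_univ, MeasurableSet.univ, by simp⟩
  obtain ⟨x, hx⟩ := mem_range_of_exists_le_of_exists_ge (continuous_cdf μ hμ)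
    ((ProbabilityTheory.tendsto_cdf_atBot μ).eventually_le_const h₀).exists
    ((ProbabilityTheory.tendsto_cdf_atTop μ).eventually_const_le h₁).exists
  exact ⟨Set.Iic x, isLowerSet_Iic x, measurableSet_Iic,
    by rw [← ProbabilityTheory.cdf_eq_real, hx]⟩

/-! ### A bound for the number of remaining tuples -/

-- An exponential moment of a count factors over the tuples, so independence makes its expectation a
-- product.
open scoped Classical in
theorem one_add_pow_countP {X : Type*} (f : X → ℝ) (D : Set ℝ) (c : ℝ) (L : List X) :
    (1 + c) ^ L.countP (fun p => f p ∈ D)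
      = (L.map (fun p => 1 + c * D.indicator 1 (f p))).prod := by
  induction L with
  | nil => simp
  | cons p L ih =>
    rw [List.countP_cons, List.map_cons, List.prod_cons, ← ih]
    by_cases h : f p ∈ D <;> simp [h, pow_succ, mul_comm]

/-- The product over the first `s` tuples of the factors `1 + c` for every tuple whose `i`-value
lies in `D`. -/
noncomputable def weight {d m : ℕ} (s : ℕ) (i : Fin d) (D : Set ℝ) (c : ℝ)
    (S : Fin m → Fin d → ℝ) : ℝ :=
  ∏ j : Fin m, if (j : ℕ) < s then 1 + c * D.indicator 1 (S j i) else 1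

open scoped Classical in
theorem weight_eq {d m : ℕ} (s : ℕ) (i : Fin d) (D : Set ℝ) (c : ℝ) (S : Fin m → Fin d → ℝ) :
    weight s i D c S = (1 + c) ^ ((List.ofFn S).take s).countP (fun p => p i ∈ D) := by
  rw [one_add_pow_countP (fun p : Fin d → ℝ => p i), List.map_take, List.map_ofFn,
    List.prod_take_ofFn, Finset.prod_filter]
  rfl

/-- The indicator of the event that none of the tuples after the first `s` ones has all its values
in the sets `D i`. -/
noncomputable def avoids {d m : ℕ} (s : ℕ) (D : Fin d → Set ℝ) (S : Fin m → Fin d → ℝ) : ℝ :=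
  ∏ j : Fin m, if (j : ℕ) < s then 1 else 1 - ∏ i, (D i).indicator 1 (S j i)

/-- An upper bound for the number of tuples to which FLET applies the divide-and-conquer
algorithm. -/
noncomputable def remainingBound {d m : ℕ} (s k : ℕ) (D E : Fin d → Set ℝ)
    (S : Fin m → Fin d → ℝ) : ℝ :=
  m * ∑ i, (1 / 2) ^ k * weight s i (D i) 1 S + m * avoids s D S
    + m * ∑ i, 2 ^ k * weight s i (E i) (-(1 / 2)) S + ∑ j, ∑ i, (E i).indicator 1 (S j i)

theorem indicator_one_nonneg (D : Set ℝ) (x : ℝ) : 0 ≤ D.indicator (1 : ℝ → ℝ) x :=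
  Set.indicator_nonneg (fun _ _ => zero_le_one) x

theorem indicator_one_le_one (D : Set ℝ) (x : ℝ) : D.indicator (1 : ℝ → ℝ) x ≤ 1 :=
  Set.indicator_le_self' (fun _ _ => zero_le_one) x

theorem weight_nonneg {d m : ℕ} (s : ℕ) (i : Fin d) (D : Set ℝ) {c : ℝ} (hc : -1 ≤ c)
    (S : Fin m → Fin d → ℝ) : 0 ≤ weight s i D c S := by
  classical
  rw [weight_eq]
  exact pow_nonneg (by linarith) _

theorem avoids_nonneg {d m : ℕ} (s : ℕ) (D : Fin d → Set ℝ) (S : Fin m → Fin d → ℝ) :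
    0 ≤ avoids s D S := by
  refine Finset.prod_nonneg fun j _ => ?_
  split_ifs
  · exact zero_le_one
  · exact sub_nonneg.mpr (Finset.prod_le_one (fun i _ => indicator_one_nonneg _ _)
      fun i _ => indicator_one_le_one _ _)

theorem remainingBound_nonneg {d m : ℕ} (s k : ℕ) (D E : Fin d → Set ℝ)
    (S : Fin m → Fin d → ℝ) : 0 ≤ remainingBound s k D E S := by
  have h₁ : 0 ≤ ∑ i, (1 / 2 : ℝ) ^ k * weight s i (D i) 1 S := Finset.sum_nonneg fun i _ =>
    mul_nonneg (by positivity) (weight_nonneg s i _ (by norm_num) S)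
  have h₂ : 0 ≤ ∑ i, (2 : ℝ) ^ k * weight s i (E i) (-(1 / 2)) S := Finset.sum_nonneg fun i _ =>
    mul_nonneg (by positivity) (weight_nonneg s i _ (by norm_num) S)
  have h₃ : 0 ≤ ∑ j, ∑ i, (E i).indicator (1 : ℝ → ℝ) (S j i) := Finset.sum_nonneg fun j _ =>
    Finset.sum_nonneg fun i _ => indicator_one_nonneg _ _
  have h₄ := avoids_nonneg s D S
  unfold remainingBound
  positivity

/-- Deterministic, and valid for any lower sets. Each of the three failures makes one of the first
three terms at least m, by 1[N ≥ k] ≤ 2^(N - k), by 1[N < k] ≤ 2^(k - N), or because `avoids` equals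
1. Otherwise the last term counts the survivors. -/
theorem fletRemaining_length_le_remainingBound {d m : ℕ} {D E : Fin d → Set ℝ}
    (hD : ∀ i, IsLowerSet (D i)) (hE : ∀ i, IsLowerSet (E i)) (S : Fin m → Fin d → ℝ) :
    ((fletRemaining (List.ofFn S)).length : ℝ)
      ≤ remainingBound m.sqrt (quantileOrder d m) D E S := by
  classical
  set P := List.ofFn S with hP
  have h_len : P.length = m := List.length_ofFn
  set s := m.sqrt with hs
  set k := quantileOrder d m with hk
  have hk1 : 1 ≤ k := one_le_quantileOrder d m
  have h_le : ((fletRemaining P).length : ℝ) ≤ m := by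
    exact_mod_cast (fletRemaining_length_le P).trans h_len.le
  have n₁ : ∀ i, 0 ≤ (1 / 2 : ℝ) ^ k * weight s i (D i) 1 S := fun i =>
    mul_nonneg (by positivity) (weight_nonneg s i _ (by norm_num) S)
  have n₂ : ∀ i, 0 ≤ (2 : ℝ) ^ k * weight s i (E i) (-(1 / 2)) S := fun i =>
    mul_nonneg (by positivity) (weight_nonneg s i _ (by norm_num) S)
  have n₃ : 0 ≤ ∑ j, ∑ i, (E i).indicator (1 : ℝ → ℝ) (S j i) := Finset.sum_nonneg fun j _ =>
    Finset.sum_nonneg fun i _ => indicator_one_nonneg _ _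
  have n₄ := avoids_nonneg s D S
  have n₁' := Finset.sum_nonneg fun i (_ : i ∈ Finset.univ) => n₁ i
  have n₂' := Finset.sum_nonneg fun i (_ : i ∈ Finset.univ) => n₂ i
  have hm : (0 : ℝ) ≤ m := Nat.cast_nonneg m
  have m₁ := mul_nonneg hm n₁'
  have m₂ := mul_nonneg hm n₂'
  have m₄ := mul_nonneg hm n₄
  unfold remainingBound
  by_cases c₁ : ∃ i, k ≤ (P.take s).countP (fun p => p i ∈ D i)
  · obtain ⟨i, hi⟩ := c₁
    have h₁ : 1 ≤ (1 / 2 : ℝ) ^ k * weight s i (D i) 1 S := by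
      rw [weight_eq, one_div, inv_pow, ← div_eq_inv_mul, one_le_div (by positivity)]
      norm_num
      exact pow_le_pow_right₀ one_le_two hi
    have h₂ := Finset.single_le_sum (fun i _ => n₁ i) (Finset.mem_univ i)
    have h₃ := mul_le_mul_of_nonneg_left (h₁.trans h₂) hm
    linarith
  by_cases c₂ : ∃ i, (P.take s).countP (fun p => p i ∈ E i) < k
  · obtain ⟨i, hi⟩ := c₂
    have h₁ : 1 ≤ (2 : ℝ) ^ k * weight s i (E i) (-(1 / 2)) S := by
      rw [weight_eq, show (1 + -(1 / 2) : ℝ) = 2⁻¹ by norm_num, inv_pow, ← div_eq_mul_inv,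
        one_le_div (by positivity)]
      exact pow_le_pow_right₀ one_le_two hi.le
    have h₂ := Finset.single_le_sum (fun i _ => n₂ i) (Finset.mem_univ i)
    have h₃ := mul_le_mul_of_nonneg_left (h₁.trans h₂) hm
    linarith
  by_cases c₃ : ∃ j, ∀ i, S j i ∈ D i
  -- Now every x i lies outside D i and inside E i. A tuple with all values in the lower sets D i is
  -- therefore ≤ x. A survivor has some value ≤ x i, which lies in E i.
  · push Not at c₁ c₂
    obtain ⟨j, hj⟩ := c₃
    have h_point : fletPoint P = (virtualPoint (P.take s) k (List.finRange d)).val := by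
      rw [fletPoint, h_len]
    have h_fst : (scan (fletPoint P) P).val.1 = true := by
      refine (scan_fst _ _).mpr ⟨S j, List.mem_ofFn.mpr ⟨j, rfl⟩, fun y hy => ?_⟩
      rw [h_point] at hy
      have hy' := (mem_virtualPoint hk1 hy (hD y.1)).not.mpr (c₁ y.1).not_ge
      by_contra! hlt
      exact hy' (hD y.1 hlt.le (hj y.1))
    rw [fletRemaining, if_pos h_fst, scan_snd, ← List.countP_eq_length_filter]
    have h_count : ∀ L : List (Fin d → ℝ),
        (L.countP (fun p => !(allGt p (fletPoint P)).val) : ℝ)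
          ≤ (L.map fun p => ∑ i, (E i).indicator (1 : ℝ → ℝ) (p i)).sum := by
      intro L
      induction L with
      | nil => simp
      | cons p L ih =>
        rw [List.countP_cons, List.map_cons, List.sum_cons, Nat.cast_add, add_comm]
        refine add_le_add ?_ ih
        split_ifs with hp
        · have hp' : ¬ ∀ y ∈ fletPoint P, y.2 y.1 < p y.1 := by
            rw [← allGt_val]
            simpa using hp
          push Not at hp'
          obtain ⟨y, hy, hyp⟩ := hp'
          rw [h_point] at hy
          have hyE := (mem_virtualPoint hk1 hy (hE y.1)).mpr (c₂ y.1)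
          have h₁ : (E y.1).indicator (1 : ℝ → ℝ) (p y.1) = 1 :=
            Set.indicator_of_mem (hE y.1 hyp hyE) _
          rw [Nat.cast_one, ← h₁]
          exact Finset.single_le_sum (f := fun i => (E i).indicator (1 : ℝ → ℝ) (p i))
            (fun i _ => indicator_one_nonneg _ _) (Finset.mem_univ y.1)
        · simpa using Finset.sum_nonneg fun i _ => indicator_one_nonneg _ _
    have h := h_count P
    rw [hP, List.map_ofFn, List.sum_ofFn] at h
    simp only [Function.comp_apply, ← hP] at h
    linarith
  · have h₁ : avoids s D S = 1 := by
      refine Finset.prod_eq_one fun j _ => ?_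
      split_ifs
      · rfl
      · push Not at c₃
        obtain ⟨i, hi⟩ := c₃ j
        rw [Finset.prod_eq_zero (Finset.mem_univ i) (Set.indicator_of_notMem hi _), sub_zero]
    rw [h₁]
    linarith

/-! ### The expected number of remaining tuples -/

section Expectation

variable {d m : ℕ} (μ : Fin d → Measure ℝ) [∀ i, IsProbabilityMeasure (μ i)]

theorem integrable_indicator_one (ν : Measure ℝ) [IsProbabilityMeasure ν] {D : Set ℝ}
    (hD : MeasurableSet D) : Integrable (D.indicator (1 : ℝ → ℝ)) ν :=
  (integrable_const (1 : ℝ)).indicator hD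

theorem integrable_weight_factor (i : Fin d) {D : Set ℝ} (hD : MeasurableSet D) (c : ℝ) :
    Integrable (fun p : Fin d → ℝ => 1 + c * D.indicator (1 : ℝ → ℝ) (p i)) (Measure.pi μ) :=
  (integrable_const 1).add ((integrable_comp_eval (integrable_indicator_one (μ i) hD)).const_mul c)

theorem integrable_weight (s : ℕ) (i : Fin d) {D : Set ℝ} (hD : MeasurableSet D) (c : ℝ) :
    Integrable (weight (m := m) s i D c) (Measure.pi fun _ => Measure.pi μ) := by
  refine Integrable.fintype_prod (μ := fun _ : Fin m => Measure.pi μ)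
    (f := fun (j : Fin m) (p : Fin d → ℝ) =>
      if (j : ℕ) < s then 1 + c * D.indicator 1 (p i) else 1) fun j => ?_
  split_ifs
  · exact integrable_weight_factor μ i hD c
  · exact integrable_const 1

theorem integral_indicator_one_eval (i : Fin d) {D : Set ℝ} (hD : MeasurableSet D) :
    ∫ p, D.indicator (1 : ℝ → ℝ) (p i) ∂(Measure.pi μ) = (μ i).real D := by
  rw [integral_comp_eval (μ := μ) (i := i) (f := D.indicator (1 : ℝ → ℝ))
    (integrable_indicator_one (μ i) hD).aestronglyMeasurable, integral_indicator_one hD]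

theorem card_filter_lt {s : ℕ} (hs : s ≤ m) :
    (Finset.univ.filter fun j : Fin m => (j : ℕ) < s).card = s := by
  rw [Fin.card_filter_val_lt, min_eq_right hs]

theorem integral_weight {s : ℕ} (hs : s ≤ m) (i : Fin d) {D : Set ℝ} (hD : MeasurableSet D)
    (c : ℝ) :
    ∫ S, weight (m := m) s i D c S ∂(Measure.pi fun _ => Measure.pi μ)
      = (1 + c * (μ i).real D) ^ s := by
  unfold weight
  rw [integral_fintype_prod_eq_prod (μ := fun _ : Fin m => Measure.pi μ)
    (fun (j : Fin m) (p : Fin d → ℝ) =>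
      if (j : ℕ) < s then 1 + c * D.indicator 1 (p i) else 1)]
  have h : ∀ j : Fin m, ∫ p : Fin d → ℝ,
      (if (j : ℕ) < s then 1 + c * D.indicator 1 (p i) else 1) ∂(Measure.pi μ)
        = if (j : ℕ) < s then 1 + c * (μ i).real D else 1 := by
    intro j
    split_ifs
    · rw [integral_add (integrable_const 1)
        ((integrable_comp_eval (integrable_indicator_one (μ i) hD)).const_mul c), integral_const_mul,
        integral_indicator_one_eval μ i hD]
      simp
    · simp
  rw [Finset.prod_congr rfl fun j _ => h j, ← Finset.prod_filter, Finset.prod_const,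
    card_filter_lt hs]

theorem integrable_prod_indicator {D : Fin d → Set ℝ} (hD : ∀ i, MeasurableSet (D i)) :
    Integrable (fun p : Fin d → ℝ => ∏ i, (D i).indicator (1 : ℝ → ℝ) (p i)) (Measure.pi μ) :=
  Integrable.fintype_prod (f := fun i => (D i).indicator (1 : ℝ → ℝ))
    fun i => integrable_indicator_one (μ i) (hD i)

theorem integrable_avoids (s : ℕ) {D : Fin d → Set ℝ} (hD : ∀ i, MeasurableSet (D i)) :
    Integrable (avoids (m := m) s D) (Measure.pi fun _ => Measure.pi μ) := by
  refine Integrable.fintype_prod (μ := fun _ : Fin m => Measure.pi μ)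
    (f := fun (j : Fin m) (p : Fin d → ℝ) =>
      if (j : ℕ) < s then 1 else 1 - ∏ i, (D i).indicator 1 (p i)) fun j => ?_
  split_ifs
  · exact integrable_const 1
  · exact (integrable_const 1).sub (integrable_prod_indicator μ hD)

theorem integral_avoids {s : ℕ} (hs : s ≤ m) {D : Fin d → Set ℝ}
    (hD : ∀ i, MeasurableSet (D i)) :
    ∫ S, avoids (m := m) s D S ∂(Measure.pi fun _ => Measure.pi μ)
      = (1 - ∏ i, (μ i).real (D i)) ^ (m - s) := by
  unfold avoids
  rw [integral_fintype_prod_eq_prod (μ := fun _ : Fin m => Measure.pi μ)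
    (fun (j : Fin m) (p : Fin d → ℝ) =>
      if (j : ℕ) < s then 1 else 1 - ∏ i, (D i).indicator 1 (p i))]
  have h : ∀ j : Fin m, ∫ p : Fin d → ℝ,
      (if (j : ℕ) < s then 1 else 1 - ∏ i, (D i).indicator 1 (p i)) ∂(Measure.pi μ)
        = if ¬ (j : ℕ) < s then 1 - ∏ i, (μ i).real (D i) else 1 := by
    intro j
    split_ifs
    · simp
    · rw [integral_sub (integrable_const 1) (integrable_prod_indicator μ hD),
        integral_fintype_prod_eq_prod (μ := μ) (fun i => (D i).indicator (1 : ℝ → ℝ))]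
      simp [integral_indicator_one (hD _)]
  have h_card : (Finset.univ.filter fun j : Fin m => ¬ (j : ℕ) < s).card = m - s := by
    rw [Finset.filter_not, Finset.card_sdiff_of_subset (Finset.filter_subset _ _),
      card_filter_lt hs, Finset.card_univ, Fintype.card_fin]
  rw [Finset.prod_congr rfl fun j _ => h j, ← Finset.prod_filter, Finset.prod_const, h_card]

theorem integrable_indicator_sum {E : Fin d → Set ℝ} (hE : ∀ i, MeasurableSet (E i)) (j : Fin m)
    (i : Fin d) : Integrable (fun S : Fin m → Fin d → ℝ => (E i).indicator (1 : ℝ → ℝ) (S j i))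
      (Measure.pi fun _ => Measure.pi μ) :=
  integrable_comp_eval (μ := fun _ : Fin m => Measure.pi μ) (i := j)
    (f := fun p : Fin d → ℝ => (E i).indicator (1 : ℝ → ℝ) (p i))
    (integrable_comp_eval (integrable_indicator_one (μ i) (hE i)))

theorem integral_indicator_sum {E : Fin d → Set ℝ} (hE : ∀ i, MeasurableSet (E i)) (j : Fin m)
    (i : Fin d) : ∫ S : Fin m → Fin d → ℝ, (E i).indicator (1 : ℝ → ℝ) (S j i)
      ∂(Measure.pi fun _ => Measure.pi μ) = (μ i).real (E i) := by
  rw [integral_comp_eval (μ := fun _ : Fin m => Measure.pi μ) (i := j)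
    (f := fun p : Fin d → ℝ => (E i).indicator (1 : ℝ → ℝ) (p i)),
    integral_indicator_one_eval μ i (hE i)]
  exact (integrable_comp_eval (integrable_indicator_one (μ i) (hE i))).aestronglyMeasurable

theorem integrable_remainingBound (s k : ℕ) {D E : Fin d → Set ℝ}
    (hD : ∀ i, MeasurableSet (D i)) (hE : ∀ i, MeasurableSet (E i)) :
    Integrable (remainingBound (m := m) s k D E) (Measure.pi fun _ => Measure.pi μ) :=
  ((((integrable_finsetSum _ fun i _ => (integrable_weight μ s i (hD i) 1).const_mul _).const_mul
    _).add ((integrable_avoids μ s hD).const_mul _)).add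
    ((integrable_finsetSum _ fun i _ => (integrable_weight μ s i (hE i) _).const_mul _).const_mul
    _)).add (integrable_finsetSum _ fun j _ => integrable_finsetSum _ fun i _ =>
      integrable_indicator_sum μ hE j i)

theorem integral_remainingBound {s : ℕ} (hs : s ≤ m) (k : ℕ) {D E : Fin d → Set ℝ}
    (hD : ∀ i, MeasurableSet (D i)) (hE : ∀ i, MeasurableSet (E i)) {u v : ℝ}
    (hu : ∀ i, (μ i).real (D i) = u) (hv : ∀ i, (μ i).real (E i) = v) :
    ∫ S, remainingBound (m := m) s k D E S ∂(Measure.pi fun _ => Measure.pi μ)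
      = m * (d * ((1 / 2) ^ k * (1 + u) ^ s) + (1 - u ^ d) ^ (m - s)
        + d * (2 ^ k * (1 - v / 2) ^ s) + d * v) := by
  have i₁ := (integrable_finsetSum Finset.univ fun i _ =>
    (integrable_weight (m := m) μ s i (hD i) 1).const_mul ((1 / 2) ^ k)).const_mul (m : ℝ)
  have i₂ := (integrable_avoids (m := m) μ s hD).const_mul (m : ℝ)
  have i₃ := (integrable_finsetSum Finset.univ fun i _ =>
    (integrable_weight (m := m) μ s i (hE i) (-(1 / 2))).const_mul (2 ^ k)).const_mul (m : ℝ)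
  have i₄ := integrable_finsetSum Finset.univ fun (j : Fin m) _ =>
    integrable_finsetSum Finset.univ fun i _ => integrable_indicator_sum μ hE j i
  have i₅ : Integrable (fun S => m * ∑ i, (1 / 2) ^ k * weight (m := m) s i (D i) 1 S
    + m * avoids s D S) (Measure.pi fun _ => Measure.pi μ) := i₁.add i₂
  have i₆ : Integrable (fun S => m * ∑ i, (1 / 2) ^ k * weight (m := m) s i (D i) 1 S
    + m * avoids s D S + m * ∑ i, 2 ^ k * weight s i (E i) (-(1 / 2)) S)
    (Measure.pi fun _ => Measure.pi μ) := i₅.add i₃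
  unfold remainingBound
  rw [integral_add i₆ i₄, integral_add i₅ i₃, integral_add i₁ i₂,
    integral_const_mul, integral_const_mul, integral_const_mul,
    integral_finsetSum _ fun i _ => (integrable_weight μ s i (hD i) 1).const_mul _,
    integral_finsetSum _ fun i _ => (integrable_weight μ s i (hE i) _).const_mul _,
    integral_finsetSum _ fun j _ => integrable_finsetSum _ fun i _ =>
      integrable_indicator_sum μ hE j i, integral_avoids μ hs hD]
  simp only [integral_const_mul, integral_weight μ hs _ (hD _), integral_weight μ hs _ (hE _),
    integral_finsetSum _ fun i _ => integrable_indicator_sum μ hE _ i,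
    integral_indicator_sum μ hE, hu, hv, Finset.sum_const, Finset.prod_const, Finset.card_univ,
    Fintype.card_fin, nsmul_eq_mul, one_mul]
  rw [show 1 + -(1 / 2) * v = 1 - v / 2 by ring]
  ring

end Expectation

/-! ### Asymptotics of the quantile order -/

section Asymptotics

variable {d m : ℕ}

theorem le_four_mul_sqrt_pow (hd : 2 ≤ d) (hm : 1 ≤ m) : m ≤ 4 * m.sqrt ^ d := by
  have h₁ : 1 ≤ m.sqrt := Nat.sqrt_pos.mpr hm
  have h₂ := Nat.lt_succ_sqrt' m
  have h₃ : m.sqrt ^ 2 ≤ m.sqrt ^ d := Nat.pow_le_pow_right h₁ hd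
  rw [Nat.succ_eq_add_one] at h₂
  nlinarith

/-- Since s^d ≥ s² ≥ m/4, the defining inequality gives k^d ≥ ⌊log₂ m⌋ / 4. Thus k grows at least
like a power of log m, which makes exp(-k/4) negligible against powers of log m. -/
theorem log_succ_le_quantileOrder_pow (hd : 2 ≤ d) (hm : 1 ≤ m) :
    Nat.log 2 m + 1 ≤ 5 * quantileOrder d m ^ d := by
  have h₁ : m.sqrt ^ d * Nat.log 2 m ≤ m.sqrt ^ d * (4 * quantileOrder d m ^ d) := by
    calc _ ≤ quantileOrder d m ^ d * m := le_quantileOrder_pow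
      _ ≤ quantileOrder d m ^ d * (4 * m.sqrt ^ d) := by
        gcongr
        exact le_four_mul_sqrt_pow hd hm
      _ = _ := by ring
  have h₂ := Nat.le_of_mul_le_mul_left h₁ (pow_pos (Nat.sqrt_pos.mpr hm) d)
  have h₃ : 1 ≤ quantileOrder d m ^ d := Nat.one_le_pow _ _ (one_le_quantileOrder d m)
  omega

/-- If k ≥ 2, minimality applies to k - 1 ≥ k/2, which accounts for 2^d. If k = 1, the bound m ≤ 4
s^d accounts for 4. -/
theorem quantileOrder_pow_mul_le (hd : 2 ≤ d) (hm : 1 ≤ m) :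
    quantileOrder d m ^ d * m ≤ (2 ^ d + 4) * (m.sqrt ^ d * (Nat.log 2 m + 1)) := by
  rcases (one_le_quantileOrder d m).eq_or_lt with h | h
  · rw [← h, one_pow, one_mul]
    have := le_four_mul_sqrt_pow hd hm
    nlinarith [Nat.zero_le (2 ^ d * (m.sqrt ^ d * (Nat.log 2 m + 1))),
      Nat.zero_le (m.sqrt ^ d * Nat.log 2 m)]
  · have h₁ := quantileOrder_pred_pow_lt (d := d) (n := m) (j := quantileOrder d m - 1)
      (by omega) (by omega)
    calc quantileOrder d m ^ d * m ≤ (2 * (quantileOrder d m - 1)) ^ d * m := by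
          gcongr
          omega
      _ = 2 ^ d * ((quantileOrder d m - 1) ^ d * m) := by rw [mul_pow, mul_assoc]
      _ ≤ 2 ^ d * (m.sqrt ^ d * Nat.log 2 m) := by gcongr
      _ ≤ _ := by gcongr <;> omega

/-- The d-th power of the left side is at most a constant times L^(pd + 1) / m, which is bounded.
The extra 1 in the constant forces x ≥ 1 in the argument by contradiction, so that x ≤ x^d. -/
theorem exists_log_pow_mul_quantile_le (hd : 2 ≤ d) (p : ℕ) :
    ∃ C : ℝ, 0 ≤ C ∧ ∀ m : ℕ, 1 ≤ m →
      ((Nat.log 2 m + 1 : ℕ) : ℝ) ^ p * (quantileOrder d m / m.sqrt) ≤ C := by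
  obtain ⟨C, hC⟩ := exists_log_pow_le (p * d + 1)
  refine ⟨(2 ^ d + 4) * C + 1, by positivity, fun m hm => ?_⟩
  have hs : (0 : ℝ) < m.sqrt := by exact_mod_cast Nat.sqrt_pos.mpr hm
  have hm' : (0 : ℝ) < m := by exact_mod_cast hm
  have h₁ : ((quantileOrder d m ^ d * m : ℕ) : ℝ)
      ≤ ((2 ^ d + 4) * (m.sqrt ^ d * (Nat.log 2 m + 1)) : ℕ) :=
    Nat.cast_le.mpr (quantileOrder_pow_mul_le hd hm)
  have h₂ : (((Nat.log 2 m + 1) ^ (p * d + 1) : ℕ) : ℝ) ≤ (C * m : ℕ) := Nat.cast_le.mpr (hC m hm)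
  rw [Nat.cast_mul, Nat.cast_mul, Nat.cast_mul, Nat.cast_pow, Nat.cast_pow] at h₁
  rw [Nat.cast_mul, Nat.cast_pow] at h₂
  generalize ((Nat.log 2 m + 1 : ℕ) : ℝ) = L at *
  have h_two : ((2 ^ d + 4 : ℕ) : ℝ) = 2 ^ d + 4 := by push_cast; ring
  rw [h_two] at h₁
  by_contra! hlt
  set x := L ^ p * ((quantileOrder d m : ℝ) / m.sqrt) with hx
  have hx1 : 1 ≤ x := by
    have : (0 : ℝ) ≤ (2 ^ d + 4) * C := by positivity
    linarith
  have hxd : x ≤ x ^ d := le_self_pow₀ hx1 (by omega)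
  have h₃ : x ^ d * (m * (m.sqrt : ℝ) ^ d) ≤ ((2 ^ d + 4) * C) * (m * (m.sqrt : ℝ) ^ d) := by
    -- After generalizing `L`, its sign is no longer visible; x ≥ 1 excludes a negative `L ^ p`.
    have hL : 0 ≤ L ^ (p * d) := by
      rw [mul_comm, pow_mul']
      by_contra! hneg
      have : L ^ p < 0 := by
        by_contra! h0
        exact absurd (pow_nonneg h0 d) hneg.not_ge
      have : x ≤ 0 := mul_nonpos_of_nonpos_of_nonneg this.le (by positivity)
      linarith
    calc x ^ d * (m * (m.sqrt : ℝ) ^ d)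
        = L ^ (p * d) * ((quantileOrder d m : ℝ) ^ d * m) := by
          rw [hx, mul_pow, div_pow, ← pow_mul]
          field_simp
      _ ≤ L ^ (p * d) * ((2 ^ d + 4) * ((m.sqrt : ℝ) ^ d * L)) := by gcongr
      _ = (2 ^ d + 4) * (m.sqrt : ℝ) ^ d * L ^ (p * d + 1) := by ring
      _ ≤ (2 ^ d + 4) * (m.sqrt : ℝ) ^ d * (C * m) := by gcongr
      _ = _ := by ring
  have h₄ := le_of_mul_le_mul_right h₃ (by positivity)
  linarith

theorem exists_log_pow_mul_exp_quantileOrder_le (hd : 2 ≤ d) (p : ℕ) :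
    ∃ C : ℝ, 0 ≤ C ∧ ∀ m : ℕ, 1 ≤ m →
      ((Nat.log 2 m + 1 : ℕ) : ℝ) ^ p * Real.exp (-(quantileOrder d m / 4)) ≤ C := by
  obtain ⟨C, hC0, hC⟩ := exists_pow_le_mul_exp (d * p) (c := 1 / 4) (by norm_num)
  refine ⟨5 ^ p * C, by positivity, fun m hm => ?_⟩
  have h₁ : ((Nat.log 2 m + 1 : ℕ) : ℝ) ≤ 5 * (quantileOrder d m : ℝ) ^ d := by
    exact_mod_cast log_succ_le_quantileOrder_pow hd hm
  rw [Real.exp_neg, ← div_eq_mul_inv, div_le_iff₀ (Real.exp_pos _)]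
  calc ((Nat.log 2 m + 1 : ℕ) : ℝ) ^ p ≤ (5 * (quantileOrder d m : ℝ) ^ d) ^ p := by gcongr
    _ = 5 ^ p * (quantileOrder d m : ℝ) ^ (d * p) := by rw [mul_pow, pow_mul]
    _ ≤ 5 ^ p * (C * Real.exp (1 / 4 * quantileOrder d m)) := by
      gcongr
      exact hC _ (Nat.cast_nonneg _)
    _ = _ := by rw [mul_assoc, one_div_mul_eq_div]

/-- With u^d m ≥ ⌊log₂ m⌋ / 4^d and m - s ≥ m/2, the power is at most exp(-c ⌊log₂ m⌋) for c =
1/(2·4^d). The factor exp(c) in the constant compensates for the shift from ⌊log₂ m⌋ to ⌊log₂ m⌋ +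
1. -/
theorem exists_log_pow_mul_avoids_le (d p : ℕ) :
    ∃ C : ℝ, 0 ≤ C ∧ ∀ m : ℕ, 1 ≤ m →
      ((Nat.log 2 m + 1 : ℕ) : ℝ) ^ p
        * (1 - (quantileOrder d m / (4 * m.sqrt) : ℝ) ^ d) ^ (m - m.sqrt) ≤ C := by
  obtain ⟨C, hC0, hC⟩ := exists_pow_le_mul_exp p (c := 1 / (2 * 4 ^ d)) (by positivity)
  refine ⟨C * Real.exp (1 / (2 * 4 ^ d)), by positivity, fun m hm => ?_⟩
  have hs : (0 : ℝ) < m.sqrt := by exact_mod_cast Nat.sqrt_pos.mpr hm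
  have hm' : (0 : ℝ) < m := by exact_mod_cast hm
  have hk : (quantileOrder d m : ℝ) ≤ m.sqrt := by exact_mod_cast quantileOrder_le hm
  have hu1 : (quantileOrder d m / (4 * m.sqrt) : ℝ) ≤ 1 := by
    rw [div_le_one (by positivity)]
    linarith
  have h₁ : ((m.sqrt ^ d * Nat.log 2 m : ℕ) : ℝ) ≤ (quantileOrder d m ^ d * m : ℕ) :=
    Nat.cast_le.mpr le_quantileOrder_pow
  push_cast at h₁
  have h₂ : (Nat.log 2 m : ℝ) / 4 ^ d ≤ (quantileOrder d m / (4 * m.sqrt) : ℝ) ^ d * m := by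
    rw [div_pow, mul_pow, div_mul_eq_mul_div, div_le_div_iff₀ (by positivity) (by positivity)]
    nlinarith [mul_le_mul_of_nonneg_left h₁ (by positivity : (0 : ℝ) ≤ 4 ^ d)]
  -- The inequality m ≤ 2(m - s) fails for m = 1; the logarithmic factor, zero there, saves the
  -- case.
  have h₃ : (Nat.log 2 m : ℝ) * m ≤ Nat.log 2 m * (2 * (m - m.sqrt : ℕ)) := by
    rcases hm.eq_or_lt with rfl | hm2
    · simp
    · gcongr
      have : m.sqrt * 2 ≤ m := by
        have h₄ := Nat.sqrt_le' m
        rcases Nat.lt_or_ge m.sqrt 2 with h₅ | h₅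
        · omega
        · nlinarith
      exact_mod_cast (by omega : m ≤ 2 * (m - m.sqrt))
  set u := (quantileOrder d m / (4 * m.sqrt) : ℝ) with hu
  have hu0 : 0 ≤ u := by positivity
  have h₄ : (Nat.log 2 m : ℝ) * (1 / (2 * 4 ^ d)) ≤ u ^ d * (m - m.sqrt : ℕ) := by
    have h₅ : (Nat.log 2 m : ℝ) * m ≤ (4 ^ d * (u ^ d * (2 * (m - m.sqrt : ℕ)))) * m := by
      rw [div_le_iff₀ (by positivity)] at h₂
      calc (Nat.log 2 m : ℝ) * m ≤ Nat.log 2 m * (2 * (m - m.sqrt : ℕ)) := h₃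
        _ ≤ (u ^ d * m * 4 ^ d) * (2 * (m - m.sqrt : ℕ)) := by gcongr
        _ = _ := by ring
    have h₆ := le_of_mul_le_mul_right h₅ hm'
    rw [mul_one_div, div_le_iff₀ (by positivity)]
    linarith
  have h_pow : (1 - u ^ d) ^ (m - m.sqrt)
      ≤ Real.exp (-((Nat.log 2 m : ℝ) * (1 / (2 * 4 ^ d)))) := by
    calc (1 - u ^ d) ^ (m - m.sqrt) ≤ Real.exp (-u ^ d) ^ (m - m.sqrt) :=
          pow_le_pow_left₀ (sub_nonneg.mpr (pow_le_one₀ hu0 hu1)) (Real.one_sub_le_exp_neg _) _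
      _ = Real.exp (-(u ^ d * (m - m.sqrt : ℕ))) := by
        rw [← Real.exp_nat_mul]
        congr 1
        ring
      _ ≤ _ := Real.exp_le_exp.mpr (neg_le_neg h₄)
  calc _ ≤ (C * Real.exp (1 / (2 * 4 ^ d) * (Nat.log 2 m + 1 : ℕ)))
        * Real.exp (-((Nat.log 2 m : ℝ) * (1 / (2 * 4 ^ d)))) := by
        refine mul_le_mul (hC _ (Nat.cast_nonneg _)) h_pow ?_ (by positivity)
        exact pow_nonneg (sub_nonneg.mpr (pow_le_one₀ hu0 hu1)) _
    _ = _ := by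
      rw [mul_assoc, ← Real.exp_add]
      congr 2
      push_cast
      ring

/-- Upper-tail estimate at u = k/(4s): the moment is at most e^(k/4), while 2^(-k) ≤ e^(-k/2). -/
theorem half_pow_mul_le_exp {k s : ℕ} (hs : 1 ≤ s) :
    (1 / 2 : ℝ) ^ k * (1 + k / (4 * s)) ^ s ≤ Real.exp (-(k / 4)) := by
  have hs' : (0 : ℝ) < s := by exact_mod_cast hs
  have h₁ : (1 + k / (4 * s) : ℝ) ^ s ≤ Real.exp (k / 4) := by
    calc (1 + k / (4 * s) : ℝ) ^ s ≤ Real.exp (k / (4 * s)) ^ s := by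
          gcongr
          rw [add_comm]
          exact Real.add_one_le_exp _
      _ = Real.exp (k / 4) := by
        rw [← Real.exp_nat_mul]
        congr 1
        field_simp
  have h₂ : (1 / 2 : ℝ) ^ k ≤ Real.exp (-(k / 2)) := by
    calc (1 / 2 : ℝ) ^ k ≤ Real.exp (-(1 / 2)) ^ k := by
          gcongr
          linarith [Real.one_sub_le_exp_neg (1 / 2)]
      _ = _ := by
        rw [← Real.exp_nat_mul]
        congr 1
        ring
  calc _ ≤ Real.exp (-(k / 2)) * Real.exp (k / 4) := by gcongr
    _ = _ := by
      rw [← Real.exp_add]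
      congr 1
      ring

/-- Lower-tail estimate. For v = 4k/s the product is at most e^k e^(-2k). If v is capped at 1, it is
2^(k - s) ≤ 1 = v, which is why v appears on the right. -/
theorem two_pow_mul_le {k s : ℕ} (hs : 1 ≤ s) (hk : k ≤ s) :
    (2 : ℝ) ^ k * (1 - min 1 (4 * ((k : ℝ) / s)) / 2) ^ s
      ≤ Real.exp (-(k / 4)) + min 1 (4 * ((k : ℝ) / s)) := by
  have hs' : (0 : ℝ) < s := by exact_mod_cast hs
  have hk0 : (0 : ℝ) ≤ k := Nat.cast_nonneg k
  rcases le_total (1 : ℝ) (4 * (k / s)) with h | h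
  · rw [min_eq_left h]
    have h₁ : (2 : ℝ) ^ k * (1 - 1 / 2) ^ s ≤ 1 := by
      calc (2 : ℝ) ^ k * (1 - 1 / 2) ^ s ≤ 2 ^ s * (1 - 1 / 2) ^ s := by
            gcongr
            norm_num
        _ = 1 := by
          rw [← mul_pow]
          norm_num
    linarith [Real.exp_pos (-(k / 4 : ℝ))]
  · rw [min_eq_right h]
    have h₁ : (1 - 4 * (k / s) / 2 : ℝ) ^ s ≤ Real.exp (-(2 * k)) := by
      calc (1 - 4 * (k / s) / 2 : ℝ) ^ s ≤ Real.exp (-(4 * (k / s) / 2)) ^ s :=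
            pow_le_pow_left₀ (by linarith) (Real.one_sub_le_exp_neg _) _
        _ = _ := by
          rw [← Real.exp_nat_mul]
          congr 1
          field_simp
          ring
    have h₂ : (2 : ℝ) ^ k ≤ Real.exp k := by
      calc (2 : ℝ) ^ k ≤ Real.exp 1 ^ k := by
            gcongr
            linarith [Real.add_one_le_exp 1]
        _ = _ := by rw [← Real.exp_nat_mul, mul_one]
    have h₃ : (0 : ℝ) ≤ 4 * (k / s) := by positivity
    calc (2 : ℝ) ^ k * (1 - 4 * (k / s) / 2) ^ s ≤ Real.exp k * Real.exp (-(2 * k)) := by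
          refine mul_le_mul h₂ h₁ (pow_nonneg (by linarith) _) (by positivity)
      _ = Real.exp (-k) := by
        rw [← Real.exp_add]
        congr 1
        ring
      _ ≤ Real.exp (-(k / 4)) := Real.exp_le_exp.mpr (by linarith)
      _ ≤ _ := by linarith

theorem exists_log_pow_mul_expected_le (hd : 2 ≤ d) (p : ℕ) :
    ∃ C : ℝ, 0 ≤ C ∧ ∀ m : ℕ, 1 ≤ m → ∀ u v : ℝ, u = quantileOrder d m / (4 * m.sqrt) →
      v = min 1 (4 * ((quantileOrder d m : ℝ) / m.sqrt)) →
      ((Nat.log 2 m + 1 : ℕ) : ℝ) ^ p * (d * ((1 / 2) ^ quantileOrder d m * (1 + u) ^ m.sqrt)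
        + (1 - u ^ d) ^ (m - m.sqrt)
        + d * (2 ^ quantileOrder d m * (1 - v / 2) ^ m.sqrt) + d * v) ≤ C := by
  obtain ⟨C₁, h₁, hC₁⟩ := exists_log_pow_mul_exp_quantileOrder_le hd p
  obtain ⟨C₂, h₂, hC₂⟩ := exists_log_pow_mul_avoids_le d p
  obtain ⟨C₃, h₃, hC₃⟩ := exists_log_pow_mul_quantile_le hd p
  refine ⟨d * C₁ + C₂ + d * (C₁ + 4 * C₃) + d * (4 * C₃), by positivity, ?_⟩
  rintro m hm u v rfl rfl
  have hs : 1 ≤ m.sqrt := Nat.sqrt_pos.mpr hm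
  have a₁ := half_pow_mul_le_exp (k := quantileOrder d m) hs
  have a₃ := two_pow_mul_le (k := quantileOrder d m) hs (quantileOrder_le hm)
  have b₁ := hC₁ m hm
  have b₂ := hC₂ m hm
  have b₃ := hC₃ m hm
  have hL : 0 ≤ ((Nat.log 2 m + 1 : ℕ) : ℝ) ^ p := by positivity
  have hv : min 1 (4 * ((quantileOrder d m : ℝ) / m.sqrt)) ≤ 4 * (quantileOrder d m / m.sqrt) :=
    min_le_right _ _
  generalize ((Nat.log 2 m + 1 : ℕ) : ℝ) ^ p = L at *
  have c₁ := (mul_le_mul_of_nonneg_left a₁ hL).trans b₁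
  have c₄ : L * min 1 (4 * ((quantileOrder d m : ℝ) / m.sqrt)) ≤ 4 * C₃ := by
    have := mul_le_mul_of_nonneg_left hv hL
    linarith
  have c₃ : L * (2 ^ quantileOrder d m
      * (1 - min 1 (4 * ((quantileOrder d m : ℝ) / m.sqrt)) / 2) ^ m.sqrt) ≤ C₁ + 4 * C₃ := by
    have := mul_le_mul_of_nonneg_left a₃ hL
    linarith
  have hd' : (0 : ℝ) ≤ d := Nat.cast_nonneg d
  have e₁ := mul_le_mul_of_nonneg_left c₁ hd'
  have e₃ := mul_le_mul_of_nonneg_left c₃ hd'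
  have e₄ := mul_le_mul_of_nonneg_left c₄ hd'
  linarith

end Asymptotics

/-! ### Worst-case and average-case bounds -/

section Bounds

variable {d : ℕ}

/-- For m ≥ 2 the added 1 is itself at most log₂ m; at m = 1 the right side would vanish. -/
theorem log_two_succ_le {m : ℕ} (hm : 2 ≤ m) :
    ((Nat.log 2 m + 1 : ℕ) : ℝ) ≤ 2 / Real.log 2 * Real.log m := by
  have h2 : 0 < Real.log 2 := Real.log_pos one_lt_two
  have h₁ : (Nat.log 2 m : ℝ) * Real.log 2 ≤ Real.log m := by
    rw [← Real.log_pow]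
    refine Real.log_le_log (by positivity) ?_
    exact_mod_cast Nat.pow_log_le_self 2 (by omega)
  have h₂ : Real.log 2 ≤ Real.log m := Real.log_le_log two_pos (by exact_mod_cast hm)
  rw [div_mul_eq_mul_div, le_div_iff₀ h2]
  push_cast
  linarith

theorem exists_worstCaseTime_le (hd : 2 ≤ d) :
    ∃ C : ℝ, 0 ≤ C ∧ ∀ (n m : ℕ) (h : m ≤ n), 2 ≤ m →
      worstCaseTime d h ≤ ENNReal.ofReal (C * ((m : ℝ) * Real.log m ^ max (d - 2) 1)) := by
  obtain ⟨C, hC⟩ := flet_cost (α := ℝ) hd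
  refine ⟨(6 + 2 * C) * (2 / Real.log 2) ^ max (d - 2) 1, ?_, fun n m h hm => ?_⟩
  · have := Real.log_pos one_lt_two
    positivity
  refine iSup_le fun T => iSup_le fun ρ => ?_
  rw [← ENNReal.ofReal_natCast]
  refine ENNReal.ofReal_le_ofReal ?_
  obtain ⟨σ, -, hσ⟩ := baseline_cost (d := d) (α := ℝ) h ρ
  rw [hσ]
  have h₁ := hC (List.ofFn (T ∘ σ)) (by rw [List.length_ofFn]; omega)
  have h₂ := fletRemaining_length_le (List.ofFn (T ∘ σ))
  rw [List.length_ofFn] at h₁ h₂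
  have h₃ := log_two_succ_le hm
  generalize max (d - 2) 1 = p at *
  have h_one : 1 ≤ (Nat.log 2 m + 1) ^ p := Nat.one_le_pow _ _ (Nat.succ_pos _)
  have h₄ : 5 * m + 1 + (flet (List.ofFn (T ∘ σ))).cost
      ≤ (6 + 2 * C) * (m * (Nat.log 2 m + 1) ^ p) := by
    generalize (Nat.log 2 m + 1) ^ p = Q at *
    have h₅ : C * (m + Q * (fletRemaining (List.ofFn (T ∘ σ))).length)
        ≤ C * (m * Q + Q * m) := by
      gcongr
      exact Nat.le_mul_of_pos_right _ h_one
    have h₆ : m ≤ m * Q := Nat.le_mul_of_pos_right _ h_one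
    have h₇ : C * (m * Q + Q * m) = 2 * C * (m * Q) := by ring
    rw [add_mul]
    omega
  calc ((5 * m + 1 + (flet (List.ofFn (T ∘ σ))).cost : ℕ) : ℝ)
      ≤ ((6 + 2 * C) * (m * (Nat.log 2 m + 1) ^ p) : ℕ) := Nat.cast_le.mpr h₄
    _ = (6 + 2 * C) * (m * ((Nat.log 2 m + 1 : ℕ) : ℝ) ^ p) := by push_cast; ring
    _ ≤ (6 + 2 * C) * (m * (2 / Real.log 2 * Real.log m) ^ p) := by gcongr
    _ = _ := by rw [mul_pow]; ring

/-- For each draw the cost is dominated by the same function `B` of the sample, whose expectation is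
linear in m. Averaging over the draws preserves the bound. -/
theorem exists_averageTime_le (hd : 2 ≤ d) :
    ∃ C : ℝ, 0 ≤ C ∧ ∀ (n m : ℕ) (h : m ≤ n), 1 ≤ m → ∀ μ : Fin d → Measure ℝ,
      (∀ i, IsProbabilityMeasure (μ i)) → (∀ i x, μ i {x} = 0) →
        averageTime μ h ≤ ENNReal.ofReal (C * m) := by
  obtain ⟨C, hC⟩ := flet_cost (α := ℝ) hd
  obtain ⟨C', hC'0, hC'⟩ := exists_log_pow_mul_expected_le hd (max (d - 2) 1)
  refine ⟨6 + C + C * C', by positivity, fun n m h hm μ _ hμ => ?_⟩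
  have hm1 : (1 : ℝ) ≤ m := by exact_mod_cast hm
  have hs : (0 : ℝ) < m.sqrt := by exact_mod_cast Nat.sqrt_pos.mpr hm
  have hk : (quantileOrder d m : ℝ) ≤ m.sqrt := by exact_mod_cast quantileOrder_le hm
  obtain ⟨u, hu⟩ : ∃ u : ℝ, u = quantileOrder d m / (4 * m.sqrt) := ⟨_, rfl⟩
  obtain ⟨v, hv⟩ : ∃ v : ℝ, v = min 1 (4 * ((quantileOrder d m : ℝ) / m.sqrt)) := ⟨_, rfl⟩
  have hu1 : u ≤ 1 := by
    rw [hu, div_le_one (by positivity)]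
    linarith
  choose D hD_lower hD_meas hD using fun i =>
    exists_isLowerSet_measureReal_eq (μ i) (hμ i) (u := u) (by rw [hu]; positivity) hu1
  choose E hE_lower hE_meas hE using fun i =>
    exists_isLowerSet_measureReal_eq (μ i) (hμ i) (u := v) (by rw [hv]; positivity)
      (by rw [hv]; exact min_le_left _ _)
  have h_exp := hC' m hm u v hu hv
  set R : (Fin m → Fin d → ℝ) → ℝ := remainingBound m.sqrt (quantileOrder d m) D E with hR
  have h_int : Integrable R (Measure.pi fun _ => Measure.pi μ) :=
    integrable_remainingBound μ _ _ hD_meas hE_meas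
  have h_intR : ∫ S, R S ∂(Measure.pi fun _ => Measure.pi μ) = _ :=
    integral_remainingBound μ (Nat.sqrt_le_self m) (quantileOrder d m) hD_meas hE_meas hD hE
  set L : ℝ := ((Nat.log 2 m + 1 : ℕ) : ℝ) ^ max (d - 2) 1 with hL
  have hL0 : 0 ≤ L := by positivity
  set B : (Fin m → Fin d → ℝ) → ℝ := fun S => (6 + C) * m + C * L * R S with hB
  have hB_int : Integrable B (Measure.pi fun _ => Measure.pi μ) :=
    (integrable_const _).add (h_int.const_mul _)
  have hB_nonneg : ∀ S, 0 ≤ B S := fun S => by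
    have : 0 ≤ R S := remainingBound_nonneg _ _ _ _ S
    positivity
  have h_intB : ∫ S, B S ∂(Measure.pi fun _ => Measure.pi μ) ≤ (6 + C + C * C') * m := by
    have h_eq : ∫ S, B S ∂(Measure.pi fun _ => Measure.pi μ)
        = (6 + C) * m + C * L * ∫ S, R S ∂(Measure.pi fun _ => Measure.pi μ) := by
      rw [hB, integral_add (integrable_const _) (h_int.const_mul _),
        integral_const_mul (C * L : ℝ) R]
      simp
    rw [h_eq, h_intR]
    have h₁ := mul_le_mul_of_nonneg_left h_exp (by positivity : (0 : ℝ) ≤ C * m)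
    linarith
  have hB_lintegral : ∫⁻ S, ENNReal.ofReal (B S) ∂(Measure.pi fun _ => Measure.pi μ)
      ≤ ENNReal.ofReal ((6 + C + C * C') * m) := by
    rw [← ofReal_integral_eq_lintegral_ofReal hB_int (ae_of_all _ hB_nonneg)]
    exact ENNReal.ofReal_le_ofReal h_intB
  choose σ hσ hσ_cost using fun ρ => baseline_cost (d := d) (α := ℝ) h ρ
  have h_cost : ∀ (T : Fin n → Fin d → ℝ) (ρ : Draws n m),
      ((baseline h T ρ).cost : ℝ≥0∞) ≤ ENNReal.ofReal (B (T ∘ σ ρ)) := by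
    intro T ρ
    rw [← ENNReal.ofReal_natCast]
    refine ENNReal.ofReal_le_ofReal ?_
    rw [hσ_cost]
    have h₁ := hC (List.ofFn (T ∘ σ ρ)) (by rwa [List.length_ofFn])
    have h₂ := fletRemaining_length_le_remainingBound hD_lower hE_lower (T ∘ σ ρ)
    rw [List.length_ofFn] at h₁
    have h₃ : ((flet (List.ofFn (T ∘ σ ρ))).cost : ℝ)
        ≤ C * (m + L * (fletRemaining (List.ofFn (T ∘ σ ρ))).length) := by
      rw [hL]
      exact_mod_cast h₁
    have h₄ : (C : ℝ) * (m + L * (fletRemaining (List.ofFn (T ∘ σ ρ))).length)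
        ≤ C * (m + L * R (T ∘ σ ρ)) := by gcongr
    simp only [hB]
    push_cast
    linarith
  have hB_ae : AEMeasurable (fun S => ENNReal.ofReal (B S)) (Measure.pi fun _ => Measure.pi μ) :=
    hB_int.aemeasurable.ennreal_ofReal
  have h_mp := fun ρ => measurePreserving_comp_injective (Measure.pi μ) (hσ ρ)
  have h_ae : ∀ ρ, AEMeasurable (fun T : Fin n → Fin d → ℝ => ENNReal.ofReal (B (T ∘ σ ρ)))
      (Measure.pi fun _ => Measure.pi μ) := fun ρ =>
    hB_ae.comp_quasiMeasurePreserving (h_mp ρ).quasiMeasurePreserving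
  have h_comp : ∀ ρ, ∫⁻ T : Fin n → Fin d → ℝ, ENNReal.ofReal (B (T ∘ σ ρ))
      ∂(Measure.pi fun _ => Measure.pi μ) ≤ ENNReal.ofReal ((6 + C + C * C') * m) := by
    intro ρ
    have := (h_mp ρ).map_eq
    rw [← this] at hB_lintegral hB_ae
    rwa [lintegral_map' hB_ae (h_mp ρ).measurable.aemeasurable] at hB_lintegral
  calc averageTime μ h
      ≤ ∫⁻ T : Fin n → Fin d → ℝ, (∑ ρ : Draws n m, ENNReal.ofReal (B (T ∘ σ ρ)))
          * (Fintype.card (Draws n m) : ℝ≥0∞)⁻¹ ∂(Measure.pi fun _ => Measure.pi μ) := by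
        -- Monotonicity holds without measurability of the step count; only the majorant has to be
        -- measurable.
        refine lintegral_mono fun T => ?_
        rw [← div_eq_mul_inv]
        exact ENNReal.div_le_div_right (Finset.sum_le_sum fun ρ _ => h_cost T ρ) _
    _ = (∑ ρ : Draws n m, ∫⁻ T : Fin n → Fin d → ℝ, ENNReal.ofReal (B (T ∘ σ ρ))
          ∂(Measure.pi fun _ => Measure.pi μ)) * (Fintype.card (Draws n m) : ℝ≥0∞)⁻¹ := by
        rw [lintegral_mul_const'' _ (Finset.aemeasurable_fun_sum _ fun ρ _ => h_ae ρ),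
          lintegral_finsetSum' _ fun ρ _ => h_ae ρ]
    _ ≤ (∑ _ρ : Draws n m, ENNReal.ofReal ((6 + C + C * C') * m))
          * (Fintype.card (Draws n m) : ℝ≥0∞)⁻¹ := by
        gcongr with ρ
        exact h_comp ρ
    _ ≤ ENNReal.ofReal ((6 + C + C * C') * m) := by
        rw [Finset.sum_const, Finset.card_univ, nsmul_eq_mul, mul_assoc, ← div_eq_mul_inv]
        exact ENNReal.mul_div_le

end Bounds

/-! ### Sublinear sample sizes -/

section Sublinear

theorem rootSize_cast_le (k : ℝ) (n : ℕ) : (rootSize k n : ℝ) ≤ (n : ℝ) ^ (1 / k) :=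
  Nat.floor_le (by positivity)

theorem two_le_rootSize {k : ℝ} {n : ℕ} (h : 2 ≤ (n : ℝ) ^ (1 / k)) : 2 ≤ rootSize k n :=
  Nat.le_floor (by exact_mod_cast h)

theorem one_le_rootSize {k : ℝ} (hk : 1 < k) {n : ℕ} (hn : 1 ≤ n) : 1 ≤ rootSize k n := by
  refine Nat.le_floor ?_
  rw [Nat.cast_one]
  exact Real.one_le_rpow (by exact_mod_cast hn) (by positivity)

theorem tendsto_root {k : ℝ} (hk : 1 < k) :
    Tendsto (fun n : ℕ => (n : ℝ) ^ (1 / k)) atTop atTop :=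
  (tendsto_rpow_atTop (by positivity)).comp tendsto_natCast_atTop_atTop

/-- With y = n^(1/k) one has n = y^(k - 1) · y, so the quotient is C (log y)^p / y^(k - 1), and k >
1. -/
theorem tendsto_root_mul_log_pow_div {k : ℝ} (hk : 1 < k) (C : ℝ) (p : ℕ) :
    Tendsto (fun n : ℕ => ENNReal.ofReal
      (C * ((n : ℝ) ^ (1 / k) * Real.log ((n : ℝ) ^ (1 / k)) ^ p)) / n) atTop (𝓝 0) := by
  have h₁ : Tendsto (fun x : ℝ => Real.log x ^ p / x ^ (k - 1)) atTop (𝓝 0) := by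
    have := (isLittleO_log_rpow_rpow_atTop (p : ℝ) (sub_pos.mpr hk)).tendsto_div_nhds_zero
    simpa only [Real.rpow_natCast] using this
  have h₂ := ENNReal.tendsto_ofReal ((h₁.comp (tendsto_root hk)).const_mul C)
  rw [mul_zero, ENNReal.ofReal_zero] at h₂
  refine h₂.congr' ?_
  filter_upwards [eventually_ge_atTop 1] with n hn
  have hn' : (0 : ℝ) < n := by exact_mod_cast hn
  have hx : (0 : ℝ) < (n : ℝ) ^ (1 / k) := Real.rpow_pos_of_pos hn' _
  rw [← ENNReal.ofReal_natCast n, ← ENNReal.ofReal_div_of_pos hn']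
  congr 1
  have h_pow : (n : ℝ) = ((n : ℝ) ^ (1 / k)) ^ (k - 1) * (n : ℝ) ^ (1 / k) := by
    rw [← Real.rpow_add_one hx.ne', sub_add_cancel, ← Real.rpow_mul hn'.le,
      one_div_mul_cancel (by positivity), Real.rpow_one]
  have hx' : (0 : ℝ) < ((n : ℝ) ^ (1 / k)) ^ (k - 1) := Real.rpow_pos_of_pos hx _
  simp only [Function.comp_apply]
  conv_rhs => rw [div_eq_mul_inv]; arg 2; rw [h_pow]
  field_simp

theorem tendsto_div_zero_of_le {k : ℝ} (hk : 1 < k) {C : ℝ} {p : ℕ} {f : ℕ → ℝ≥0∞}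
    (h : ∀ᶠ n : ℕ in atTop, f n ≤ ENNReal.ofReal
      (C * ((n : ℝ) ^ (1 / k) * Real.log ((n : ℝ) ^ (1 / k)) ^ p))) :
    Tendsto (fun n : ℕ => f n / n) atTop (𝓝 0) := by
  refine tendsto_of_tendsto_of_tendsto_of_le_of_le' tendsto_const_nhds
    (tendsto_root_mul_log_pow_div hk C p) (Eventually.of_forall fun _ => zero_le) ?_
  filter_upwards [h] with n hn
  exact ENNReal.div_le_div_right hn _

end Sublinear

end SkylineSampling

/-! ### Assembly of the bounds. -/

theorem mainTheorem11 (d : ℕ) (hd : 2 ≤ d) :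
    ∃ C : ℝ,
      -- sample size `m`: worst case and average case
      (∀ (n m : ℕ) (h : m ≤ n), 2 ≤ m →
        SkylineSampling.worstCaseTime d h
          ≤ ENNReal.ofReal (C * ((m : ℝ) * Real.log (m : ℝ) ^ max (d - 2) 1))) ∧
      (∀ (n m : ℕ) (h : m ≤ n), 1 ≤ m →
        ∀ μ : Fin d → Measure ℝ, (∀ i, IsProbabilityMeasure (μ i)) → (∀ i x, μ i {x} = 0) →
          SkylineSampling.averageTime μ h ≤ ENNReal.ofReal (C * (m : ℝ))) ∧
      -- sample size `n ^ (1 / k)`: worst case and average case, and sublinearity of both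
      (∀ (k : ℝ) (hk : 1 < k),
        (∀ n : ℕ, 2 ≤ (n : ℝ) ^ (1 / k) →
          SkylineSampling.worstCaseTime d (SkylineSampling.rootSize_le hk n)
            ≤ ENNReal.ofReal
                (C * ((n : ℝ) ^ (1 / k) * Real.log ((n : ℝ) ^ (1 / k)) ^ max (d - 2) 1))) ∧
        (∀ n : ℕ, 1 ≤ n →
          ∀ μ : Fin d → Measure ℝ, (∀ i, IsProbabilityMeasure (μ i)) → (∀ i x, μ i {x} = 0) →
            SkylineSampling.averageTime μ (SkylineSampling.rootSize_le hk n)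
              ≤ ENNReal.ofReal (C * (n : ℝ) ^ (1 / k))) ∧
        Tendsto (fun n : ℕ =>
            SkylineSampling.worstCaseTime d (SkylineSampling.rootSize_le hk n) / (n : ℝ≥0∞))
          atTop (𝓝 0) ∧
        (∀ μ : Fin d → Measure ℝ, (∀ i, IsProbabilityMeasure (μ i)) → (∀ i x, μ i {x} = 0) →
          Tendsto (fun n : ℕ =>
              SkylineSampling.averageTime μ (SkylineSampling.rootSize_le hk n) / (n : ℝ≥0∞))
            atTop (𝓝 0))) := by
  obtain ⟨C₁, h₁, hW⟩ := SkylineSampling.exists_worstCaseTime_le hd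
  obtain ⟨C₂, h₂, hA⟩ := SkylineSampling.exists_averageTime_le hd
  have hW' : ∀ (n m : ℕ) (h : m ≤ n), 2 ≤ m → SkylineSampling.worstCaseTime d h
      ≤ ENNReal.ofReal ((C₁ + C₂) * ((m : ℝ) * Real.log (m : ℝ) ^ max (d - 2) 1)) := by
    intro n m h hm
    refine (hW n m h hm).trans (ENNReal.ofReal_le_ofReal ?_)
    have : 0 ≤ Real.log m := Real.log_natCast_nonneg m
    gcongr
    linarith
  have hA' : ∀ (n m : ℕ) (h : m ≤ n), 1 ≤ m → ∀ μ : Fin d → Measure ℝ,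
      (∀ i, IsProbabilityMeasure (μ i)) → (∀ i x, μ i {x} = 0) →
        SkylineSampling.averageTime μ h ≤ ENNReal.ofReal ((C₁ + C₂) * (m : ℝ)) := by
    intro n m h hm μ hμ hμ'
    refine (hA n m h hm μ hμ hμ').trans (ENNReal.ofReal_le_ofReal ?_)
    gcongr
    linarith
  have hW_root : ∀ k : ℝ, ∀ hk : 1 < k, ∀ n : ℕ, 2 ≤ (n : ℝ) ^ (1 / k) →
      SkylineSampling.worstCaseTime d (SkylineSampling.rootSize_le hk n) ≤ ENNReal.ofReal
        ((C₁ + C₂) * ((n : ℝ) ^ (1 / k) * Real.log ((n : ℝ) ^ (1 / k)) ^ max (d - 2) 1)) := by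
    intro k hk n hn
    have hm := SkylineSampling.two_le_rootSize hn
    refine (hW' n _ _ hm).trans (ENNReal.ofReal_le_ofReal ?_)
    -- The bound at m = ⌊n^(1/k)⌋ passes to n^(1/k) by monotonicity of the logarithm.
    have hm' : (0 : ℝ) < SkylineSampling.rootSize k n := by exact_mod_cast (by omega)
    have h_le := SkylineSampling.rootSize_cast_le k n
    have h_log := Real.log_natCast_nonneg (SkylineSampling.rootSize k n)
    have h_log' := Real.log_le_log hm' h_le
    gcongr
  have hA_root : ∀ k : ℝ, ∀ hk : 1 < k, ∀ n : ℕ, 1 ≤ n → ∀ μ : Fin d → Measure ℝ,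
      (∀ i, IsProbabilityMeasure (μ i)) → (∀ i x, μ i {x} = 0) →
        SkylineSampling.averageTime μ (SkylineSampling.rootSize_le hk n)
          ≤ ENNReal.ofReal ((C₁ + C₂) * (n : ℝ) ^ (1 / k)) := by
    intro k hk n hn μ hμ hμ'
    refine (hA' n _ _ (SkylineSampling.one_le_rootSize hk hn) μ hμ hμ').trans
      (ENNReal.ofReal_le_ofReal ?_)
    have h_le := SkylineSampling.rootSize_cast_le k n
    gcongr
  refine ⟨C₁ + C₂, hW', hA', fun k hk => ⟨hW_root k hk, hA_root k hk, ?_, fun μ hμ hμ' => ?_⟩⟩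
  · refine SkylineSampling.tendsto_div_zero_of_le hk (C := C₁ + C₂) (p := max (d - 2) 1) ?_
    filter_upwards [(SkylineSampling.tendsto_root hk).eventually_ge_atTop 2] with n hn
    exact hW_root k hk n hn
  -- Exponent 0 removes the logarithmic factor.
  · refine SkylineSampling.tendsto_div_zero_of_le hk (C := C₁ + C₂) (p := 0) ?_
    filter_upwards [eventually_ge_atTop 1] with n hn
    simpa using hA_root k hk n hn μ hμ hμ'
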